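/- **Setting.** Let $(\mathcal S,\mathcal A,P,r)$ be a weakly communicating average-reward Markov decision process with finite $\mathcal S,\mathcal A$, $S=|\mathcal S|$, $A=|\mathcal A|$, and rewards $r(s,a)\in[0,1]$. Let $J^\star$ be its optimal gain, that is the maximum over stationary deterministic policies of the long-run average reward (which does not depend on the initial state), and let $h^\star:\mathcal S\to\mathbb R$ be an optimal bias function, i.e. $J^\star+h^\star(s)=\max_a[r(s,a)+\sum_{s'}P(s'|s,a)h^\star(s')]$ for all $s$. Put $\|h^\star\|_{\mathsf{sp}}=\max_s h^\star(s)-\min_s h^\star(s)$ and assume $\|h^\star\|_{\mathsf{sp}}\ge c_0$ for a constant $c_0>0$. A generative model provides independent samples $s_{k,t}(s,a)\sim P(\cdot|s,a)$ for all epochs $k\ge1$, iterations $t\ge 1$ and pairs $(s,a)$. Epoch-wise synchronous Q-learning with epoch lengths $N_k$, discount factors $\gamma_k$ and learning rates $\eta_{k,t}$ starts from $Q_{1,0}=0$, sets $Q_{k,0}=Q_{k-1,N_{k-1}}$ for $k\ge2$, and for $t=1,\dots,N_k$ and all $(s,a)$ performs $$Q_{k,t}(s,a)=(1-\eta_{k,t})Q_{k,t-1}(s,a)+\eta_{k,t}\big((1-\gamma_k)r(s,a)+\gamma_kV_{\iota(k,t)}(s_{k,t}(s,a))\big),\qquad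 V_{k,t}(s)=\max_aQ_{k,t}(s,a).$$ **Theorem.** Let $\delta\in(0,1)$. 1. *First schedule.* Let $N_k=\max(1000,2^k)$, $\eta_{k,t}=\big(1+\frac{t^{2/3}}{8\log(4t)}\big)^{-1}$, $\iota(k,t)=(k,t-1)$, and let $\gamma_k$ satisfy $c_1\frac{\log(4N_k)}{N_k^{1/3}}\le1-\gamma_k\le c_2\frac{\log^q(4N_k)}{N_k^{1/3}}$ for all $k\ge1$, with constants $c_1,c_2>0$ and $q\in\mathbb N$. There are $C>0$ and $p\in\mathbb N$ that depend only on $c_0,c_1,c_2,q$ such that for every $K\ge1$, with probability at least $1-\delta$, $$\|Q_{K,N_K}-J^\star\|_\infty\le C\,\log^p\!\Big(\frac{SAN_K}{\delta}\Big)\frac{\|h^\star\|_{\mathsf{sp}}}{N_K^{1/3}}.$$ Moreover, for every $\varepsilon\in(0,1]$ there is $K_0\ge1$ such that the first $K_0$ epochs use at most $$SA\sum_{k=1}^{K_0}N_k\le C\,\log^p\!\Big(2+\frac{SA\|h^\star\|_{\mathsf{sp}}}{\varepsilon\delta}\Big)\,SA\Big(\frac{\|h^\star\|_{\mathsf{sp}}}{\varepsilon}\Big)^3$$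 samples, and for every $K\ge K_0$ one has $\|Q_{K,N_K}-J^\star\|_\infty\le\varepsilon$ with probability at least $1-\delta$. 2. *Second schedule.* Let $\gamma_k=\frac{k}{k+1}$, $N_k=\big\lceil c_Nk^2\log^5(k+1)\log^3(SA/\delta)\big\rceil$, $\eta_{k,t}=\big(1+\frac{N_k}{4\log(N_1+\dots+N_k)}\big)^{-1}$, $\iota(k,t)=(k,0)$, i.e. $V_{\iota(k,t)}=V_{k-1,N_{k-1}}$ for $k\ge 2$. There is a universal constant such that, whenever $c_N$ is at least that constant, for every $K\ge2$, with probability at least $1-\delta$, $$\|Q_{K,N_K}-J^\star\|_\infty\le C'\,\frac{\|h^\star\|_{\mathsf{sp}}\log K}{K},$$ where $C'>0$ depends only on $c_0$. -/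

import Mathlib

open MeasureTheory ProbabilityTheory Filter

universe u v w

/-- A finite Markov decision process with deterministic rewards in `[0,1]`;
`P s a s'` is the probability of moving from `s` to `s'` under action `a`. -/
structure FiniteMDP (S A : Type*) [Fintype S] where
  P : S → A → S → ℝ
  r : S → A → ℝ
  P_nonneg : ∀ s a s', 0 ≤ P s a s'
  P_sum : ∀ s a, ∑ s', P s a s' = 1
  r_nonneg : ∀ s a, 0 ≤ r s a
  r_le_one : ∀ s a, r s a ≤ 1

namespace FiniteMDP

noncomputable section

variable {S A : Type*} [Fintype S]

/-- The state transition matrix `P^π` of the stationary deterministic policy `π`. -/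
def policyMatrix (M : FiniteMDP S A) (π : S → A) : Matrix S S ℝ :=
  Matrix.of fun s s' => M.P s (π s) s'

/-- Expected average reward of `π` over the first `T` steps, started in `s`. -/
def avgReward [DecidableEq S] (M : FiniteMDP S A) (π : S → A) (s : S) (T : ℕ) : ℝ :=
  (∑ t ∈ Finset.range T,
    Matrix.mulVec (M.policyMatrix π ^ t) (fun s' => M.r s' (π s')) s) / T

/-- Long-run average reward (gain) `J^π(s)`. The averages lie in `[0,1]`, and for a finite
chain they converge, so that the lower limit is the limit. -/
def gain [DecidableEq S] (M : FiniteMDP S A) (π : S → A) (s : S) : ℝ :=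
  liminf (M.avgReward π s) atTop

/-- The optimal gain `J⋆`: the best long-run average reward. In a weakly communicating MDP the
value `⨆ π, M.gain π s` is the same for every initial state `s`, and `J⋆` is this common value. -/
def optimalGain [DecidableEq S] (M : FiniteMDP S A) : ℝ :=
  ⨆ s : S, ⨆ π : S → A, M.gain π s

/-- Weakly communicating: the states split into a nonempty closed set `C` in which every state is
accessible from every other one under some stationary deterministic policy, and states that are
transient under every stationary deterministic policy (expected number of visits is finite). -/
def IsWeaklyCommunicating [DecidableEq S] (M : FiniteMDP S A) : Prop :=
  ∃ C : Set S, C.Nonempty ∧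
    (∀ s ∈ C, ∀ a, ∀ s' ∉ C, M.P s a s' = 0) ∧
    (∀ s ∈ C, ∀ s' ∈ C, ∃ π : S → A, ∃ n : ℕ, 0 < (M.policyMatrix π ^ n) s s') ∧
    (∀ s ∉ C, ∀ π : S → A, Summable fun n : ℕ => (M.policyMatrix π ^ n) s s)

/-- `h` is an optimal bias function: together with the optimal gain it solves the Bellman
optimality equation `J⋆ + h(s) = max_a [r(s,a) + ∑_{s'} P(s'|s,a) h(s')]`. -/
def IsOptimalBias [DecidableEq S] (M : FiniteMDP S A) (h : S → ℝ) : Prop :=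
  ∀ s, M.optimalGain + h s = ⨆ a, (M.r s a + ∑ s', M.P s a s' * h s')

/-- Access to a generative model: `X k t s a` is the next state drawn from `P(·|s,a)` at
iteration `t` of epoch `k`; all draws are independent. -/
structure IsGenerativeModel {Ω : Type*} [MeasurableSpace Ω] [MeasurableSpace S]
    (M : FiniteMDP S A) (μ : Measure Ω) (X : ℕ → ℕ → S → A → Ω → S) : Prop where
  measurable : ∀ k t s a, Measurable (X k t s a)
  indep : iIndepFun (fun i : ℕ × ℕ × S × A => X i.1 i.2.1 i.2.2.1 i.2.2.2) μ
  law : ∀ k t s a s', μ.real {ω | X k t s a ω = s'} = M.P s a s'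

/-- Which value estimate the update at iteration `t` of epoch `k` bootstraps from:
the latest one `V_{k,t-1}`, or the one at the start of the epoch, `V_{k,0} = V_{k-1,N_{k-1}}`. -/
inductive Bootstrap where
  | latest
  | epochStart

/-- Parameters of epoch-wise Q-learning. Epochs are `k = 1, 2, …`, and epoch `k` has the
iterations `t = 1, …, N k`. -/
structure Schedule where
  N : ℕ → ℕ
  γ : ℕ → ℝ
  η : ℕ → ℕ → ℝ
  bootstrap : Bootstrap

/-- Synchronous Q-learning within one epoch that starts from the estimate `Q₀`, with `x t s a` the
state sampled for `(s,a)` at iteration `t`: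
`Q_t(s,a) = (1-η_t) Q_{t-1}(s,a) + η_t ((1-γ) r(s,a) + γ V(x_t(s,a)))`, where
`V(s) = max_a Q(s,a)` for `Q = Q_{t-1}` or `Q = Q₀`. -/
def epochQ (M : FiniteMDP S A) (b : Bootstrap) (γ : ℝ) (η : ℕ → ℝ) (x : ℕ → S → A → S)
    (Q₀ : S → A → ℝ) : ℕ → S → A → ℝ
  | 0 => Q₀
  | t + 1 => fun s a =>
      (1 - η (t + 1)) * epochQ M b γ η x Q₀ t s a +
        η (t + 1) * ((1 - γ) * M.r s a + γ *
          (match b with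
            | .latest => ⨆ a', epochQ M b γ η x Q₀ t (x (t + 1) s a) a'
            | .epochStart => ⨆ a', Q₀ (x (t + 1) s a) a'))

/-- The estimate `Q_{K,N_K}` at the end of epoch `K`, with initialization `0` and
`Q_{k,0} = Q_{k-1,N_{k-1}}`; `x k t s a` is the state sampled in iteration `t` of epoch `k`. -/
def finalQ (M : FiniteMDP S A) (p : Schedule) (x : ℕ → ℕ → S → A → S) : ℕ → S → A → ℝ
  | 0 => fun _ _ => 0
  | k + 1 => M.epochQ p.bootstrap (p.γ (k + 1)) (p.η (k + 1)) (x (k + 1)) (M.finalQ p x k)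
      (p.N (k + 1))

/-- The `ℓ_∞` error `‖Q_{K,N_K} - J⋆‖_∞` on the outcome `ω`. -/
def finalError {Ω : Type*} [DecidableEq S] [Fintype A] (M : FiniteMDP S A) (p : Schedule)
    (X : ℕ → ℕ → S → A → Ω → S) (K : ℕ) (ω : Ω) : ℝ :=
  ‖fun i : S × A => M.finalQ p (fun k t s a => X k t s a ω) K i.1 i.2 - M.optimalGain‖

/-- Span semi-norm `max h - min h`. -/
def spanNorm (h : S → ℝ) : ℝ := (⨆ s, h s) - ⨅ s, h s

/-- Epoch lengths of the first schedule. -/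
def firstN (k : ℕ) : ℕ := max 1000 (2 ^ k)

/-- First schedule, with discount factors `γ`:
`η_{k,t} = 1 / (1 + t^{2/3} / (8 log(4t)))`, bootstrapping from `V_{k,t-1}`. -/
def firstSchedule (γ : ℕ → ℝ) : Schedule where
  N := firstN
  γ := γ
  η := fun _ t => 1 / (1 + (t : ℝ) ^ (2 / 3 : ℝ) / (8 * Real.log (4 * t)))
  bootstrap := .latest

/-- Epoch lengths of the second schedule: `N_k = c_N k² log⁵(k+1) log³(SA/δ)`, rounded up;
`m` stands for `SA`. -/
def secondN (cN δ : ℝ) (m k : ℕ) : ℕ :=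
  ⌈cN * (k : ℝ) ^ 2 * Real.log (k + 1) ^ 5 * Real.log (m / δ) ^ 3⌉₊

/-- Second schedule: `γ_k = k/(k+1)`, `η_{k,t} = 1 / (1 + N_k / (4 log(N_1 + ⋯ + N_k)))`,
bootstrapping from `V_{k-1,N_{k-1}}`. -/
def secondSchedule (cN δ : ℝ) (m : ℕ) : Schedule where
  N := secondN cN δ m
  γ := fun k => k / (k + 1)
  η := fun k _ => 1 / (1 + (secondN cN δ m k : ℝ) /
    (4 * Real.log (∑ j ∈ Finset.Icc 1 k, (secondN cN δ m j : ℝ))))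
  bootstrap := .epochStart

/-- Number of generative-model samples drawn in epochs `1, …, K` with `m = SA`
state-action pairs: one per pair and iteration. -/
def sampleCount (p : Schedule) (m K : ℕ) : ℕ := m * ∑ k ∈ Finset.Icc 1 K, p.N k

end

end FiniteMDP

/-! The iterates are compared with an explicit near fixed point instead of the discounted optimum.
Shift the bias to g = h⋆ - min h⋆, with values in [0, H] where H is the span, and put R = J⋆ +
(1-γ)(r - J⋆ + P g), which is `refQ`. The average-reward Bellman equation gives max_a R = J⋆ + (1-γ)
g. Hence R solves the γ-discounted equation with rewards (1-γ) r up to the residual (1-γ)² P g, and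
R lies within (1-γ)(1+H) of J⋆ (`BellmanPair.iSup_refQ`, `BellmanPair.abs_refQ_sub_le`).

Write Q_t = R + γ(1-γ) Y_t + remainder, where Y_t (`noiseAvg`) is the learning-rate average of
g(sample) - P g. Since g is fixed, Y_t is a linear combination of independent bounded variables; it
is sub-Gaussian with variance proxy η_t H²/4 (`hasSubgaussianMGF_expAvg`), and a union bound
controls all that are needed. The remainder is bounded pathwise, because V(s') - (J⋆ + (1-γ) g(s'))
is at most a sup norm at whatever state is sampled. This gives the deterministic recursions
`BellmanPair.abs_epochQ_latest_sub_le` and `BellmanPair.abs_epochQ_epochStart_sub_le`.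

First schedule: 1-γ is N^{-1/3} up to logarithms, so every error of order (1-γ)H polylog is
affordable. The noise contributes (1-γ)H Σ η_{i+1} √η_i, a harmonic sum. The initial error is
multiplied by exp(-(1-γ) Σ η_i) = O(N^{-1/3}), so one epoch forgets its start, and only boundedness
of the earlier iterates matters.

Second schedule: an epoch performs one approximate Bellman step. With 1-γ_k = 1/(k+1) the error d_k
satisfies (k+1) d_k ≤ k d_{k-1} + O((1+H)/(k+1)), where d_k is measured to the `refQ` of epoch k.
Summing gives d_k = O((1+H) log k / k), and H ≥ c₀ absorbs the 1. -/

/-! ### Finite suprema. -/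

theorem abs_ciSup_sub_ciSup_le {ι : Type*} [Finite ι] [Nonempty ι] {f g : ι → ℝ} {d : ℝ}
    (h : ∀ i, |f i - g i| ≤ d) : |(⨆ i, f i) - ⨆ i, g i| ≤ d := by
  have hf := Set.finite_range f |>.bddAbove
  have hg := Set.finite_range g |>.bddAbove
  rw [abs_le]
  constructor
  · have : (⨆ i, g i) ≤ (⨆ i, f i) + d :=
      ciSup_le fun i => by linarith [le_ciSup hf i, (abs_le.1 (h i)).1]
    linarith
  · have : (⨆ i, f i) ≤ (⨆ i, g i) + d :=
      ciSup_le fun i => by linarith [le_ciSup hg i, (abs_le.1 (h i)).2]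
    linarith

theorem abs_ciSup_le_of_forall {ι : Type*} [Finite ι] [Nonempty ι] {f : ι → ℝ} {d : ℝ}
    (h : ∀ i, |f i| ≤ d) : |⨆ i, f i| ≤ d := by
  simpa using abs_ciSup_sub_ciSup_le (f := f) (g := fun _ => 0) (d := d) (by simpa using h)

theorem ciSup_const_add_mul {ι : Type*} [Finite ι] [Nonempty ι] (f : ι → ℝ) (b : ℝ) {c : ℝ}
    (hc : 0 ≤ c) : ⨆ i, (b + c * f i) = b + c * ⨆ i, f i := by
  have hm : Monotone fun x : ℝ => b + c * x := fun x y hxy => by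
    have := mul_le_mul_of_nonneg_left hxy hc
    simpa using this
  exact (hm.map_ciSup_of_continuousAt (f := fun x : ℝ => b + c * x) (by fun_prop)
    (Set.finite_range f).bddAbove).symm

/-! ### The Bellman equation and the reference point `refQ`. -/

namespace FiniteMDP

variable {S : Type u} {A : Type v} [Fintype S]

/-- The expectation of `g` at the next state. -/
noncomputable def nextMean (M : FiniteMDP S A) (g : S → ℝ) (s : S) (a : A) : ℝ :=
  ∑ s', M.P s a s' * g s'

theorem nextMean_mem_Icc (M : FiniteMDP S A) {g : S → ℝ} {b c : ℝ}
    (hg : ∀ s, g s ∈ Set.Icc b c) (s : S) (a : A) : M.nextMean g s a ∈ Set.Icc b c := by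
  constructor
  · calc b = ∑ s', M.P s a s' * b := by rw [← Finset.sum_mul, M.P_sum, one_mul]
      _ ≤ _ := Finset.sum_le_sum fun s' _ =>
        mul_le_mul_of_nonneg_left (hg s').1 (M.P_nonneg s a s')
  · calc _ ≤ ∑ s', M.P s a s' * c := Finset.sum_le_sum fun s' _ =>
        mul_le_mul_of_nonneg_left (hg s').2 (M.P_nonneg s a s')
      _ = c := by rw [← Finset.sum_mul, M.P_sum, one_mul]

/-- `J` and `g` solve the average-reward Bellman optimality equation, and `g` takes values in
`[0, H]`. -/
structure BellmanPair (M : FiniteMDP S A) (J : ℝ) (g : S → ℝ) (H : ℝ) : Prop where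
  mem_Icc : ∀ s, g s ∈ Set.Icc 0 H
  bellman : ∀ s, J + g s = ⨆ a, (M.r s a + M.nextMean g s a)

theorem nextMean_sub_const (M : FiniteMDP S A) (h : S → ℝ) (c : ℝ) (s : S) (a : A) :
    M.nextMean (fun s => h s - c) s a = M.nextMean h s a - c := by
  simp only [nextMean, mul_sub, Finset.sum_sub_distrib, ← Finset.sum_mul, M.P_sum, one_mul]

/-- The Bellman equation is invariant under adding constants to the bias, so the bias may be
normalised to have minimum 0. -/
theorem IsOptimalBias.bellmanPair [DecidableEq S] [Finite A] [Nonempty A]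
    {M : FiniteMDP S A} {h : S → ℝ} (hh : M.IsOptimalBias h) :
    M.BellmanPair M.optimalGain (fun s => h s - ⨅ s, h s) (spanNorm h) where
  mem_Icc s := ⟨sub_nonneg.2 (ciInf_le (Set.finite_range h).bddBelow s),
    sub_le_sub_right (le_ciSup (Set.finite_range h).bddAbove s) _⟩
  bellman s := by
    have := hh s
    simp only [nextMean_sub_const]
    have e := ciSup_const_add_mul (fun a => M.r s a + M.nextMean h s a) (-⨅ s, h s) zero_le_one
    simp only [one_mul] at e
    rw [show (fun a => M.r s a + (M.nextMean h s a - ⨅ s, h s)) =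
      fun a => -(⨅ s, h s) + (M.r s a + M.nextMean h s a) by ext a; ring, e]
    simp only [nextMean]
    linarith

namespace BellmanPair

variable {M : FiniteMDP S A} {J H : ℝ} {g : S → ℝ}

/-- Evaluate the Bellman equation where g is smallest (lower bound) and where g is largest (upper
bound): there P g is on the favourable side of g. -/
theorem gain_mem_Icc [Nonempty S] [Finite A] [Nonempty A] (hB : M.BellmanPair J g H) :
    J ∈ Set.Icc (0 : ℝ) 1 := by
  obtain ⟨s₀, h₀⟩ := Finite.exists_min g
  obtain ⟨s₁, h₁⟩ := Finite.exists_max g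
  have hP := M.nextMean_mem_Icc fun s => ⟨h₀ s, h₁ s⟩
  constructor
  · have := le_ciSup (Set.finite_range fun a => M.r s₀ a + M.nextMean g s₀ a).bddAbove
      (Classical.arbitrary A)
    rw [← hB.bellman] at this
    linarith [(hP s₀ (Classical.arbitrary A)).1, M.r_nonneg s₀ (Classical.arbitrary A)]
  · have : J + g s₁ ≤ 1 + g s₁ := by
      rw [hB.bellman]
      exact ciSup_le fun a => add_le_add (M.r_le_one s₁ a) (hP s₁ a).2
    linarith

end BellmanPair

/-- A nearly exact solution of the `γ`-discounted Bellman equation built from a solution of the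
average-reward equation. -/
noncomputable def refQ (M : FiniteMDP S A) (J : ℝ) (g : S → ℝ) (γ : ℝ) (s : S) (a : A) : ℝ :=
  J + (1 - γ) * (M.r s a - J + M.nextMean g s a)

theorem BellmanPair.iSup_refQ [Finite A] [Nonempty A] {M : FiniteMDP S A} {J H : ℝ} {g : S → ℝ}
    (hB : M.BellmanPair J g H) {γ : ℝ} (hγ : γ ≤ 1) (s : S) :
    ⨆ a, M.refQ J g γ s a = J + (1 - γ) * g s := by
  have e := ciSup_const_add_mul (fun a => M.r s a + M.nextMean g s a) (J - (1 - γ) * J)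
    (sub_nonneg.2 hγ)
  rw [← hB.bellman] at e
  simp only [refQ]
  rw [show (fun a => J + (1 - γ) * (M.r s a - J + M.nextMean g s a)) =
    fun a => J - (1 - γ) * J + (1 - γ) * (M.r s a + M.nextMean g s a) by ext a; ring, e]
  ring

theorem BellmanPair.abs_refQ_sub_le [Nonempty S] [Finite A] [Nonempty A] {M : FiniteMDP S A}
    {J H : ℝ} {g : S → ℝ} (hB : M.BellmanPair J g H) {γ : ℝ} (hγ : γ ≤ 1) (s : S) (a : A) :
    |M.refQ J g γ s a - J| ≤ (1 - γ) * (1 + H) := by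
  have hJ := hB.gain_mem_Icc
  have hP := M.nextMean_mem_Icc hB.mem_Icc s a
  rw [refQ, add_sub_cancel_left, abs_mul, abs_of_nonneg (sub_nonneg.2 hγ)]
  refine mul_le_mul_of_nonneg_left (abs_le.2 ⟨?_, ?_⟩) (sub_nonneg.2 hγ)
  · linarith [hJ.2, hP.1, hP.2, M.r_nonneg s a]
  · linarith [hJ.1, hP.2, M.r_le_one s a]

/-- The noise in the sampled values of `g`, averaged as in the Q-learning recursion. -/
noncomputable def noiseAvg (M : FiniteMDP S A) (g : S → ℝ) (η : ℕ → ℝ) (x : ℕ → S → A → S) :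
    ℕ → S → A → ℝ
  | 0 => fun _ _ => 0
  | t + 1 => fun s a => (1 - η (t + 1)) * noiseAvg M g η x t s a +
      η (t + 1) * (g (x (t + 1) s a) - M.nextMean g s a)

/-! ### Pathwise error recursions within one epoch. -/

section Epoch

variable {M : FiniteMDP S A} {J H : ℝ} {g : S → ℝ} {γ : ℝ} {η : ℕ → ℝ} {x : ℕ → S → A → S}
  {Q₀ : S → A → ℝ}

/-- One step of the error recursion: `v` is the value at the sampled state. -/
theorem BellmanPair.abs_step_le (hB : M.BellmanPair J g H) (hγ : γ ∈ Set.Icc (0 : ℝ) 1)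
    {α v w y z e W : ℝ} (hα : α ∈ Set.Icc (0 : ℝ) 1) {s : S} {a : A} {s' : S}
    (hw : |w - M.refQ J g γ s a - γ * (1 - γ) * z| ≤ e)
    (hv : |v - (J + (1 - γ) * g s')| ≤ W)
    (hy : y = (1 - α) * z + α * (g s' - M.nextMean g s a)) :
    |(1 - α) * w + α * ((1 - γ) * M.r s a + γ * v) - M.refQ J g γ s a - γ * (1 - γ) * y| ≤
      (1 - α) * e + α * (γ * W + (1 - γ) ^ 2 * H) := by
  have hP := M.nextMean_mem_Icc hB.mem_Icc s a
  -- The fluctuation g(s') - P g is absorbed by y exactly; what is left over is the residual (1-γ)²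
  -- P g of `refQ` in the discounted equation.
  have key : (1 - α) * w + α * ((1 - γ) * M.r s a + γ * v) - M.refQ J g γ s a -
      γ * (1 - γ) * y = (1 - α) * (w - M.refQ J g γ s a - γ * (1 - γ) * z) +
      α * (γ * (v - (J + (1 - γ) * g s')) - (1 - γ) ^ 2 * M.nextMean g s a) := by
    rw [hy, refQ]; ring
  rw [key]
  refine (abs_add_le _ _).trans (add_le_add ?_ ?_)
  · rw [abs_mul, abs_of_nonneg (sub_nonneg.2 hα.2)]
    exact mul_le_mul_of_nonneg_left hw (sub_nonneg.2 hα.2)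
  · rw [abs_mul, abs_of_nonneg hα.1]
    refine mul_le_mul_of_nonneg_left ((abs_sub _ _).trans (add_le_add ?_ ?_)) hα.1
    · rw [abs_mul, abs_of_nonneg hγ.1]
      exact mul_le_mul_of_nonneg_left hv hγ.1
    · rw [abs_mul, abs_of_nonneg (sq_nonneg _), abs_of_nonneg hP.1]
      exact mul_le_mul_of_nonneg_left hP.2 (sq_nonneg _)

/-- If the remainder at time t is at most E, the values are off by at most E + γ(1-γ) z_t, so one
step contracts E by 1 - η(1-γ) and adds η(1-γ) z_t + η(1-γ)² H. The last input has fixed point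
(1-γ)H. The noise inputs are summed without using the contraction. -/
theorem BellmanPair.abs_epochQ_latest_sub_le [Finite A] [Nonempty A]
    (hB : M.BellmanPair J g H) (hγ : γ ∈ Set.Icc (0 : ℝ) 1)
    (hη : ∀ t, η t ∈ Set.Icc (0 : ℝ) 1) {e : ℝ} (he : ∀ s a, |Q₀ s a - M.refQ J g γ s a| ≤ e)
    {n : ℕ} {z : ℕ → ℝ} (hz : ∀ t < n, ∀ s a, |M.noiseAvg g η x t s a| ≤ z t)
    (hH : 0 ≤ H) {t : ℕ} (ht : t ≤ n) (s : S) (a : A) :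
    |M.epochQ .latest γ η x Q₀ t s a - M.refQ J g γ s a - γ * (1 - γ) * M.noiseAvg g η x t s a| ≤
      (∏ i ∈ Finset.range t, (1 - η (i + 1) * (1 - γ))) * e +
        (1 - γ) * ∑ i ∈ Finset.range t, η (i + 1) * z i + (1 - γ) * H := by
  have hγ' : 0 ≤ 1 - γ := sub_nonneg.2 hγ.2
  induction t generalizing s a with
  | zero =>
    simp only [epochQ, noiseAvg, Finset.range_zero, Finset.prod_empty, Finset.sum_empty]
    have := mul_nonneg hγ' hH
    simpa using (he s a).trans (by linarith)
  | succ t ih =>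
    have ih' := ih (by omega)
    set E := (∏ i ∈ Finset.range t, (1 - η (i + 1) * (1 - γ))) * e +
        (1 - γ) * ∑ i ∈ Finset.range t, η (i + 1) * z i + (1 - γ) * H with hE
    have hzt : 0 ≤ z t := (abs_nonneg _).trans (hz t (by omega) s a)
    have hv : ∀ s', |(⨆ a', M.epochQ .latest γ η x Q₀ t s' a') - (J + (1 - γ) * g s')| ≤
        E + (1 - γ) * γ * z t := by
      intro s'
      rw [← hB.iSup_refQ hγ.2]
      refine abs_ciSup_sub_ciSup_le fun a' => ?_
      have h1 := ih' s' a'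
      have h2 : |γ * (1 - γ) * M.noiseAvg g η x t s' a'| ≤ (1 - γ) * γ * z t := by
        rw [abs_mul, abs_of_nonneg (mul_nonneg hγ.1 hγ'), mul_comm γ]
        exact mul_le_mul_of_nonneg_left (hz t (by omega) s' a') (mul_nonneg hγ' hγ.1)
      calc _ = |(M.epochQ .latest γ η x Q₀ t s' a' - M.refQ J g γ s' a' -
            γ * (1 - γ) * M.noiseAvg g η x t s' a') +
            γ * (1 - γ) * M.noiseAvg g η x t s' a'| := by rw [sub_add_cancel]
        _ ≤ _ := (abs_add_le _ _).trans (add_le_add h1 h2)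
    refine (hB.abs_step_le hγ (hη (t + 1)) (ih' s a) (hv _) rfl).trans ?_
    rw [Finset.prod_range_succ, Finset.sum_range_succ]
    have hη' := hη (t + 1)
    have hg2 : γ * γ ≤ 1 := by nlinarith [hγ.1, hγ.2]
    have h3 : η (t + 1) * (1 - γ) * (γ * γ * z t) ≤ η (t + 1) * (1 - γ) * z t :=
      mul_le_mul_of_nonneg_left (by nlinarith) (mul_nonneg hη'.1 hγ')
    have h4 : 0 ≤ η (t + 1) * (1 - γ) * ((1 - γ) * ∑ i ∈ Finset.range t, η (i + 1) * z i) :=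
      mul_nonneg (mul_nonneg hη'.1 hγ') (mul_nonneg hγ' (Finset.sum_nonneg fun i hi =>
        mul_nonneg (hη _).1 ((abs_nonneg _).trans
          (hz i (by have := Finset.mem_range.1 hi; omega) s a))))
    rw [hE]
    linear_combination h3 + h4

/-- The target is frozen during the epoch, so the remainder is a convex combination of its initial
size and one Bellman step's error; the noise enters only through its value at time t. -/
theorem BellmanPair.abs_epochQ_epochStart_sub_le (hB : M.BellmanPair J g H)
    (hγ : γ ∈ Set.Icc (0 : ℝ) 1) (hη : ∀ t, η t ∈ Set.Icc (0 : ℝ) 1) {e W : ℝ}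
    (he : ∀ s a, |Q₀ s a - M.refQ J g γ s a| ≤ e)
    (hW : ∀ s, |(⨆ a, Q₀ s a) - (J + (1 - γ) * g s)| ≤ W) (hW0 : 0 ≤ W) (hH : 0 ≤ H)
    (t : ℕ) (s : S) (a : A) :
    |M.epochQ .epochStart γ η x Q₀ t s a - M.refQ J g γ s a -
        γ * (1 - γ) * M.noiseAvg g η x t s a| ≤
      (∏ i ∈ Finset.range t, (1 - η (i + 1))) * e + (γ * W + (1 - γ) ^ 2 * H) := by
  induction t with
  | zero =>
    have : 0 ≤ γ * W + (1 - γ) ^ 2 * H :=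
      add_nonneg (mul_nonneg hγ.1 hW0) (mul_nonneg (sq_nonneg _) hH)
    simp only [epochQ, noiseAvg, Finset.range_zero, Finset.prod_empty]
    simpa using (he s a).trans (by linarith)
  | succ t ih =>
    refine (hB.abs_step_le hγ (hη (t + 1)) ih (hW _) rfl).trans (le_of_eq ?_)
    rw [Finset.prod_range_succ]
    ring

/-- Each update is a convex combination of quantities in [-B, B]. -/
theorem abs_epochQ_le [Finite A] [Nonempty A] (b : Bootstrap) (hγ : γ ∈ Set.Icc (0 : ℝ) 1)
    (hη : ∀ t, η t ∈ Set.Icc (0 : ℝ) 1) {B : ℝ} (hB : 1 ≤ B) (hQ : ∀ s a, |Q₀ s a| ≤ B)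
    (t : ℕ) (s : S) (a : A) : |M.epochQ b γ η x Q₀ t s a| ≤ B := by
  induction t generalizing s a with
  | zero => exact hQ s a
  | succ t ih =>
    have key : ∀ v : ℝ, |v| ≤ B → |(1 - η (t + 1)) * M.epochQ b γ η x Q₀ t s a +
        η (t + 1) * ((1 - γ) * M.r s a + γ * v)| ≤ B := by
      intro v hv
      have h0 := hη (t + 1)
      have h1 := ih s a
      have hr : |M.r s a| ≤ B := by
        rw [abs_of_nonneg (M.r_nonneg s a)]; exact (M.r_le_one s a).trans hB
      rw [abs_le] at *
      have hu : (1 - γ) * M.r s a + γ * v ∈ Set.Icc (-B) B :=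
        convex_Icc (-B) B hr hv (sub_nonneg.2 hγ.2) hγ.1 (by ring)
      exact convex_Icc (-B) B h1 hu (sub_nonneg.2 h0.2) h0.1 (by ring)
    cases b
    · exact key _ (abs_ciSup_le_of_forall fun a' => ih _ a')
    · exact key _ (abs_ciSup_le_of_forall fun a' => hQ _ a')

/-- A growth bound without any restriction on the discount factor. -/
theorem abs_epochQ_latest_le_pow [Finite A] [Nonempty A] {G : ℝ} (hG : |1 - γ| ≤ G)
    (hη : ∀ t, η t ∈ Set.Icc (0 : ℝ) 1) {B : ℝ} (hB : 1 ≤ B) (hQ : ∀ s a, |Q₀ s a| ≤ B)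
    (t : ℕ) (s : S) (a : A) :
    |M.epochQ .latest γ η x Q₀ t s a| ≤ B * (2 + 2 * G) ^ t := by
  have hG0 : 0 ≤ G := (abs_nonneg _).trans hG
  induction t generalizing s a with
  | zero => simpa [epochQ] using hQ s a
  | succ t ih =>
    set D := B * (2 + 2 * G) ^ t with hD
    have hD1 : 1 ≤ D := one_le_mul_of_one_le_of_one_le hB (one_le_pow₀ (by linarith))
    have hv := abs_ciSup_le_of_forall (ih (x (t + 1) s a))
    have h0 := hη (t + 1)
    have hγ' : |γ| ≤ 1 + G := by
      have := abs_sub (1 : ℝ) (1 - γ)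
      rw [sub_sub_cancel, abs_one] at this
      linarith
    have hu : |(1 - γ) * M.r s a + γ * ⨆ a', M.epochQ .latest γ η x Q₀ t (x (t + 1) s a) a'| ≤
        (1 + 2 * G) * D := by
      refine (abs_add_le _ _).trans ?_
      rw [abs_mul, abs_mul, abs_of_nonneg (M.r_nonneg s a)]
      have h1 : |1 - γ| * M.r s a ≤ G * D :=
        mul_le_mul hG ((M.r_le_one s a).trans hD1) (M.r_nonneg s a) hG0
      have h2 := mul_le_mul hγ' hv (abs_nonneg _) (by linarith)
      linarith
    simp only [epochQ]
    refine (abs_add_le _ _).trans ?_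
    rw [abs_mul, abs_mul, abs_of_nonneg (sub_nonneg.2 h0.2), abs_of_nonneg h0.1]
    have h3 := mul_le_mul_of_nonneg_left (ih s a) (sub_nonneg.2 h0.2)
    have h4 := mul_le_mul_of_nonneg_left hu h0.1
    have h5 : 0 ≤ η (t + 1) * D := mul_nonneg h0.1 (by linarith)
    have h6 : η (t + 1) * ((1 + 2 * G) * D) ≤ 1 * ((1 + 2 * G) * D) :=
      mul_le_mul_of_nonneg_right h0.2 (mul_nonneg (by linarith) (by linarith))
    rw [pow_succ, ← mul_assoc, ← hD]
    linarith

end Epoch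

end FiniteMDP

/-! ### Sub-Gaussian concentration of the averaged noise. -/

section Concentration

open scoped NNReal

variable {Ω : Type*} [MeasurableSpace Ω] {μ : Measure Ω}

theorem ProbabilityTheory.HasSubgaussianMGF.mono {Y : Ω → ℝ} {c c' : ℝ≥0}
    (h : HasSubgaussianMGF Y c μ) (hc : c ≤ c') : HasSubgaussianMGF Y c' μ where
  integrable_exp_mul := h.integrable_exp_mul
  mgf_le t := (h.mgf_le t).trans (Real.exp_le_exp.2 (by
    have : (c : ℝ) ≤ c' := hc
    gcongr))

/-- Exponential averages of independent sub-Gaussian noise are sub-Gaussian, with a variance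
proxy proportional to the current step size. -/
theorem hasSubgaussianMGF_expAvg [IsProbabilityMeasure μ] {ξ Z : ℕ → Ω → ℝ} {η : ℕ → ℝ} {v : ℝ≥0}
    (hξ : iIndepFun ξ μ) (hsub : ∀ t, HasSubgaussianMGF (ξ t) v μ)
    (hη : ∀ t, η t ∈ Set.Icc (0 : ℝ) 1) (hstep : ∀ t, (1 - η (t + 1)) * η t ≤ η (t + 1))
    (h0 : ∀ ω, Z 0 ω = 0)
    (hZ : ∀ t ω, Z (t + 1) ω = (1 - η (t + 1)) * Z t ω + η (t + 1) * ξ (t + 1) ω) (t : ℕ) :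
    HasSubgaussianMGF (Z t) ((η t).toNNReal * v) μ := by
  obtain ⟨c, hc, hcs⟩ : ∃ c : ℕ → ℝ, (∀ ω, Z t ω = ∑ i ∈ Finset.range (t + 1), c i * ξ i ω) ∧
      ∑ i ∈ Finset.range (t + 1), c i ^ 2 ≤ η t := by
    induction t with
    | zero => exact ⟨fun _ => 0, by simp [h0], by simpa using (hη 0).1⟩
    | succ t ih =>
      obtain ⟨c, hc, hcs⟩ := ih
      have hlt : ∀ i ∈ Finset.range (t + 1), i ≤ t := fun i hi =>
        Nat.lt_succ_iff.1 (Finset.mem_range.1 hi)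
      refine ⟨fun i => if i ≤ t then (1 - η (t + 1)) * c i else η (t + 1), fun ω => ?_, ?_⟩
      · beta_reduce
        rw [hZ, hc, Finset.sum_range_succ _ (t + 1), if_neg (by omega), Finset.mul_sum]
        congr 1
        exact Finset.sum_congr rfl fun i hi => by rw [if_pos (hlt i hi), mul_assoc]
      · beta_reduce
        rw [Finset.sum_range_succ _ (t + 1), if_neg (by omega)]
        have : ∑ i ∈ Finset.range (t + 1), (if i ≤ t then (1 - η (t + 1)) * c i else η (t + 1)) ^ 2
            = (1 - η (t + 1)) ^ 2 * ∑ i ∈ Finset.range (t + 1), c i ^ 2 := by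
          rw [Finset.mul_sum]
          exact Finset.sum_congr rfl fun i hi => by rw [if_pos (hlt i hi), mul_pow]
        rw [this]
        -- With η' the new rate: (1-η')² η + η'² ≤ (1-η') η' + η'² = η', by `hstep`.
        have h1 := mul_le_mul_of_nonneg_left hcs (sq_nonneg (1 - η (t + 1)))
        have h2 := mul_le_mul_of_nonneg_left (hstep t) (sub_nonneg.2 (hη (t + 1)).2)
        nlinarith
  have hsum := HasSubgaussianMGF.sum_of_iIndepFun (X := fun i ω => c i * ξ i ω)
    (c := fun i => (c i ^ 2).toNNReal * v) (s := Finset.range (t + 1))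
    (hξ.comp (fun i y => c i * y) fun i => measurable_const_mul _)
    fun i _ => ((hsub i).const_mul (c i)).mono (mul_le_mul_left
      (NNReal.coe_le_coe.1 (Real.le_coe_toNNReal _)) _)
  rw [show Z t = fun ω => ∑ i ∈ Finset.range (t + 1), c i * ξ i ω from funext hc]
  refine hsum.mono ?_
  rw [← Finset.sum_mul]
  gcongr
  rw [← Real.toNNReal_sum_of_nonneg fun i _ => sq_nonneg (c i)]
  exact Real.toNNReal_le_toNNReal hcs

theorem ProbabilityTheory.HasSubgaussianMGF.measure_abs_ge_le {Y : Ω → ℝ} {c : ℝ≥0}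
    [IsProbabilityMeasure μ] (h : HasSubgaussianMGF Y c μ) {ε : ℝ} (hε : 0 ≤ ε) :
    μ.real {ω | ε ≤ |Y ω|} ≤ 2 * Real.exp (-ε ^ 2 / (2 * c)) := by
  have hsub : {ω | ε ≤ |Y ω|} ⊆ {ω | ε ≤ Y ω} ∪ {ω | ε ≤ (-Y) ω} := fun ω (hω : ε ≤ |Y ω|) =>
    le_abs.1 hω
  calc _ ≤ μ.real ({ω | ε ≤ Y ω} ∪ {ω | ε ≤ (-Y) ω}) := measureReal_mono hsub
    _ ≤ _ := measureReal_union_le _ _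
    _ ≤ _ := by linarith [h.measure_ge_le hε, h.neg.measure_ge_le hε]

theorem one_sub_le_measureReal_of_compl_subset [IsProbabilityMeasure μ] {ι : Type*} {I : Finset ι}
    {s : Set Ω} {t : ι → Set Ω} {δ : ℝ} (h : sᶜ ⊆ ⋃ i ∈ I, t i)
    (ht : ∑ i ∈ I, μ.real (t i) ≤ δ) : 1 - δ ≤ μ.real s := by
  have h1 : (1 : ℝ) ≤ μ.real s + μ.real sᶜ := by
    have := measureReal_union_le (μ := μ) s sᶜ
    rwa [Set.union_compl_self, probReal_univ] at this
  have h2 : μ.real sᶜ ≤ ∑ i ∈ I, μ.real (t i) :=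
    (measureReal_mono h (measure_ne_top _ _)).trans (measureReal_biUnion_finset_le I t)
  linarith

end Concentration

namespace FiniteMDP

variable {S : Type u} {A : Type v} [Fintype S] [MeasurableSpace S] [DiscreteMeasurableSpace S]
  {Ω : Type w} [MeasurableSpace Ω] {μ : Measure Ω} {M : FiniteMDP S A}
  {X : ℕ → ℕ → S → A → Ω → S} {g : S → ℝ} {H : ℝ} {η : ℕ → ℝ}

theorem IsGenerativeModel.integral_comp [IsProbabilityMeasure μ] (hX : M.IsGenerativeModel μ X)
    (g : S → ℝ) (k t : ℕ) (s : S) (a : A) : ∫ ω, g (X k t s a ω) ∂μ = M.nextMean g s a := by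
  have hm := hX.measurable k t s a
  have := MeasureTheory.Measure.isProbabilityMeasure_map (μ := μ) hm.aemeasurable
  rw [← integral_map (f := g) hm.aemeasurable
    (measurable_of_countable g).aestronglyMeasurable, integral_fintype Integrable.of_finite]
  refine Finset.sum_congr rfl fun s' _ => ?_
  rw [map_measureReal_apply hm (measurableSet_singleton s'), smul_eq_mul, ← hX.law k t s a s']
  rfl

theorem IsGenerativeModel.hasSubgaussianMGF_noiseAvg [IsProbabilityMeasure μ]
    (hX : M.IsGenerativeModel μ X) (hg : ∀ s, g s ∈ Set.Icc 0 H)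
    (hη : ∀ t, η t ∈ Set.Icc (0 : ℝ) 1) (hstep : ∀ t, (1 - η (t + 1)) * η t ≤ η (t + 1))
    (k t : ℕ) (s : S) (a : A) :
    HasSubgaussianMGF (fun ω => M.noiseAvg g η (fun t s a => X k t s a ω) t s a)
      ((η t).toNNReal * (‖H - 0‖₊ / 2) ^ 2) μ := by
  refine hasSubgaussianMGF_expAvg
    (ξ := fun t ω => g (X k t s a ω) - M.nextMean g s a)
    (Z := fun t ω => M.noiseAvg g η (fun t s a => X k t s a ω) t s a)
    ?_ (fun t => ?_) hη hstep (fun _ => rfl) (fun _ _ => rfl) t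
  · have h1 := hX.indep.precomp (g := fun t : ℕ => ((k, t, s, a) : ℕ × ℕ × S × A))
      fun t t' h => (Prod.mk.inj (Prod.mk.inj h).2).1
    exact h1.comp (fun _ y => g y - M.nextMean g s a) fun _ => measurable_of_countable _
  · have := hasSubgaussianMGF_of_mem_Icc (μ := μ) (X := fun ω => g (X k t s a ω)) (a := 0) (b := H)
      ((measurable_of_countable g).comp (hX.measurable k t s a)).aemeasurable
      (Eventually.of_forall fun ω => hg _)
    rwa [hX.integral_comp] at this

/-- The tail of the averaged noise. -/
theorem IsGenerativeModel.measure_noiseAvg_ge_le [IsProbabilityMeasure μ]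
    (hX : M.IsGenerativeModel μ X) (hg : ∀ s, g s ∈ Set.Icc 0 H) (hH : 0 < H)
    (hη : ∀ t, η t ∈ Set.Ioc (0 : ℝ) 1) (hstep : ∀ t, (1 - η (t + 1)) * η t ≤ η (t + 1))
    {L : ℝ} (hL : 0 ≤ L) (k t : ℕ) (s : S) (a : A) :
    μ.real {ω | H * Real.sqrt (η t * L) ≤
      |M.noiseAvg g η (fun t s a => X k t s a ω) t s a|} ≤ 2 * Real.exp (-L) := by
  have hpos := (hη t).1
  refine ((hX.hasSubgaussianMGF_noiseAvg hg (fun t => Set.Ioc_subset_Icc_self (hη t)) hstep k t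
    s a).measure_abs_ge_le (by positivity)).trans ?_
  refine mul_le_mul_of_nonneg_left (Real.exp_le_exp.2 ?_) zero_le_two
  rw [mul_pow, Real.sq_sqrt (by positivity)]
  push_cast
  rw [Real.coe_toNNReal _ hpos.le, sub_zero, Real.norm_of_nonneg hH.le]
  -- The Hoeffding exponent is -2L; a factor 2 is given away.
  have : -(H ^ 2 * (η t * L)) / (2 * (η t * (H / 2) ^ 2)) = -(2 * L) := by field_simp
  rw [this]
  linarith

end FiniteMDP

/-! ### Estimates for the polynomial learning rate. -/

/-- The learning rate `1 / (1 + t^{2/3} / (8 log(4t)))` of the first schedule. -/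
noncomputable def polyRate (t : ℕ) : ℝ := 1 / (1 + (t : ℝ) ^ (2 / 3 : ℝ) / (8 * Real.log (4 * t)))

theorem one_lt_log_four_mul {t : ℝ} (ht : 1 ≤ t) : 1 < Real.log (4 * t) := by
  rw [Real.lt_log_iff_exp_lt (by linarith)]
  linarith [Real.exp_one_lt_d9]

theorem polyRate_aux_nonneg (t : ℕ) : 0 ≤ (t : ℝ) ^ (2 / 3 : ℝ) / (8 * Real.log (4 * t)) := by
  rcases Nat.eq_zero_or_pos t with rfl | ht
  · simp
  · have := one_lt_log_four_mul (t := t) (by exact_mod_cast ht)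
    positivity

theorem polyRate_mem_Ioc (t : ℕ) : polyRate t ∈ Set.Ioc (0 : ℝ) 1 := by
  have := polyRate_aux_nonneg t
  exact ⟨by unfold polyRate; positivity, div_le_one_of_le₀ (by linarith) (by positivity)⟩

/-- Index 0 is never a step of the algorithm, but the noise bounds below refer to it; the value
comes from 0^{2/3} = 0. -/
theorem polyRate_zero : polyRate 0 = 1 := by simp [polyRate]

theorem add_one_rpow_two_thirds_le {x : ℝ} (hx : 0 ≤ x) :
    (x + 1) ^ (2 / 3 : ℝ) ≤ x ^ (2 / 3 : ℝ) + 1 := by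
  simpa using Real.rpow_add_le_add_rpow (p := 2 / 3) hx zero_le_one (by norm_num) (by norm_num)

/-- Writing the rate as 1/(1+f), the claim is f(t+1) ≤ 1 + f(t), which follows from subadditivity of
x^{2/3} and log(4t) > 1. This is the hypothesis under which the variance proxy stays proportional to
the current rate. -/
theorem polyRate_step (t : ℕ) : (1 - polyRate (t + 1)) * polyRate t ≤ polyRate (t + 1) := by
  have h0 := polyRate_aux_nonneg t
  have h1 := polyRate_aux_nonneg (t + 1)
  have key : ((t + 1 : ℕ) : ℝ) ^ (2 / 3 : ℝ) / (8 * Real.log (4 * (t + 1 : ℕ))) ≤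
      1 + (t : ℝ) ^ (2 / 3 : ℝ) / (8 * Real.log (4 * t)) := by
    rcases Nat.eq_zero_or_pos t with rfl | ht
    · have := one_lt_log_four_mul (t := 1) le_rfl
      simp only [zero_add, Nat.cast_one, Real.one_rpow]
      have h8 : 1 / (8 * Real.log (4 * 1)) ≤ 1 := by
        rw [div_le_one (by linarith)]; linarith
      have := polyRate_aux_nonneg 0
      linarith
    · have ht1 : (1 : ℝ) ≤ t := by exact_mod_cast ht
      have hl := one_lt_log_four_mul ht1
      have hmono : Real.log (4 * t) ≤ Real.log (4 * (t + 1 : ℕ)) :=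
        Real.log_le_log (by linarith) (by push_cast; linarith)
      calc _ ≤ ((t + 1 : ℕ) : ℝ) ^ (2 / 3 : ℝ) / (8 * Real.log (4 * t)) := by gcongr
        _ ≤ ((t : ℝ) ^ (2 / 3 : ℝ) + 1) / (8 * Real.log (4 * t)) := by
          gcongr
          push_cast
          exact add_one_rpow_two_thirds_le (by linarith)
        _ = 1 / (8 * Real.log (4 * t)) + (t : ℝ) ^ (2 / 3 : ℝ) / (8 * Real.log (4 * t)) := by ring
        _ ≤ _ := by
          gcongr
          rw [div_le_one (by linarith)]
          linarith
  unfold polyRate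
  set f := (t : ℝ) ^ (2 / 3 : ℝ) / (8 * Real.log (4 * t))
  set f' := ((t + 1 : ℕ) : ℝ) ^ (2 / 3 : ℝ) / (8 * Real.log (4 * (t + 1 : ℕ)))
  have e : (1 - 1 / (1 + f')) * (1 / (1 + f)) = f' / (1 + f) * (1 / (1 + f')) := by
    field_simp; ring
  rw [e]
  exact mul_le_of_le_one_left (by positivity) (div_le_one_of_le₀ key (by positivity))

theorem polyRate_le {t N : ℕ} (ht : t ≤ N) (hN : 1 ≤ N) :
    polyRate t ≤ 16 * Real.log (4 * N) / ((t : ℝ) + 1) ^ (2 / 3 : ℝ) := by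
  have hlN := one_lt_log_four_mul (t := N) (by exact_mod_cast hN)
  rcases Nat.eq_zero_or_pos t with rfl | ht0
  · simp only [polyRate_zero, Nat.cast_zero, zero_add, Real.one_rpow, div_one]
    linarith
  · have ht1 : (1 : ℝ) ≤ t := by exact_mod_cast ht0
    have hl := one_lt_log_four_mul ht1
    have hmono : Real.log (4 * t) ≤ Real.log (4 * N) :=
      Real.log_le_log (by linarith) (by gcongr)
    have hp : 1 ≤ (t : ℝ) ^ (2 / 3 : ℝ) := Real.one_le_rpow ht1 (by norm_num)
    have h2 := add_one_rpow_two_thirds_le (zero_le_one.trans ht1)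
    have hpos : 0 < ((t : ℝ) + 1) ^ (2 / 3 : ℝ) := by positivity
    calc polyRate t ≤ 1 / ((t : ℝ) ^ (2 / 3 : ℝ) / (8 * Real.log (4 * t))) := by
          unfold polyRate
          gcongr
          linarith
      _ = 8 * Real.log (4 * t) / (t : ℝ) ^ (2 / 3 : ℝ) := by rw [one_div_div]
      _ ≤ _ := by
          rw [div_le_div_iff₀ (by positivity) hpos]
          calc 8 * Real.log (4 * t) * ((t : ℝ) + 1) ^ (2 / 3 : ℝ)
              ≤ 8 * Real.log (4 * N) * (2 * (t : ℝ) ^ (2 / 3 : ℝ)) := by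
                gcongr
                linarith
            _ = _ := by ring

/-- The exponent 2/3 is what makes this critical: 2/3 + 1/3 = 1, so the accumulated noise is a
harmonic sum, hence polylogarithmic. -/
theorem polyRate_mul_sqrt_le {t N : ℕ} (ht : t < N) :
    polyRate (t + 1) * Real.sqrt (polyRate t) ≤ (16 * Real.log (4 * N)) ^ 2 / ((t : ℝ) + 1) := by
  have hN : 1 ≤ N := by omega
  have hlN := one_lt_log_four_mul (t := N) (by exact_mod_cast hN)
  have h1 := polyRate_le (t := t + 1) (by omega) hN
  have h0 := polyRate_le ht.le hN
  set b := 16 * Real.log (4 * N) with hb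
  have hb1 : 1 ≤ b := by linarith
  set y := ((t : ℝ) + 1) ^ (1 / 3 : ℝ) with hy
  have hy0 : 0 < y := by positivity
  have e2 : ((t : ℝ) + 1) ^ (2 / 3 : ℝ) = y ^ 2 := by
    rw [hy, ← Real.rpow_mul_natCast (by positivity)]; norm_num
  have e3 : (t : ℝ) + 1 = y ^ 3 := by
    rw [hy, ← Real.rpow_mul_natCast (by positivity)]; norm_num
  have h1' : polyRate (t + 1) ≤ b / y ^ 2 := by
    refine h1.trans ?_
    rw [← e2]
    push_cast
    gcongr
    linarith
  have h0' : Real.sqrt (polyRate t) ≤ b / y := by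
    refine Real.sqrt_le_iff.2 ⟨by positivity, h0.trans ?_⟩
    rw [e2, div_pow]
    gcongr
    nlinarith
  calc _ ≤ b / y ^ 2 * (b / y) := by gcongr
    _ = _ := by rw [e3]; field_simp

theorem sum_polyRate_mul_sqrt_le {N : ℕ} :
    ∑ i ∈ Finset.range N, polyRate (i + 1) * Real.sqrt (polyRate i) ≤
      (16 * Real.log (4 * N)) ^ 2 * (1 + Real.log N) := by
  calc _ ≤ ∑ i ∈ Finset.range N, (16 * Real.log (4 * N)) ^ 2 * ((i : ℝ) + 1)⁻¹ :=
        Finset.sum_le_sum fun i hi => by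
          rw [← div_eq_mul_inv]; exact polyRate_mul_sqrt_le (Finset.mem_range.1 hi)
    _ = (16 * Real.log (4 * N)) ^ 2 * (harmonic N : ℝ) := by
        rw [← Finset.mul_sum, harmonic]; push_cast; rfl
    _ ≤ _ := by gcongr; exact harmonic_le_one_add_log N

theorem le_polyRate {t N : ℕ} (ht0 : 1 ≤ t) (ht : t ≤ N) :
    Real.log (4 * N) / (7 * (N : ℝ) ^ (2 / 3 : ℝ)) ≤ polyRate t := by
  have ht1 : (1 : ℝ) ≤ t := by exact_mod_cast ht0
  have htN : (t : ℝ) ≤ N := by exact_mod_cast ht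
  have hl := one_lt_log_four_mul ht1
  have hlN := one_lt_log_four_mul (ht1.trans htN)
  have hpt : 1 ≤ (t : ℝ) ^ (2 / 3 : ℝ) := Real.one_le_rpow ht1 (by norm_num)
  have hpN : 1 ≤ (N : ℝ) ^ (2 / 3 : ℝ) := Real.one_le_rpow (ht1.trans htN) (by norm_num)
  -- s^{2/3}/log(4s) is increasing up to a factor 3: split log(4N) = log(4s) + log(N/s) and use log
  -- u ≤ (3/2) u^{2/3}. The case s = 1 handles the summand 1 in the denominator of the rate.
  have key : ∀ s : ℝ, 1 ≤ s → s ≤ N → s ^ (2 / 3 : ℝ) * Real.log (4 * N) ≤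
      3 * (N : ℝ) ^ (2 / 3 : ℝ) * Real.log (4 * s) := by
    intro s hs hsN
    have hN0 : (0 : ℝ) < N := by linarith
    have hs' := one_lt_log_four_mul hs
    have e : Real.log (4 * N) = Real.log (4 * s) + Real.log (N / s) := by
      rw [← Real.log_mul (by positivity) (by positivity)]
      congr 1
      field_simp
    have h1 : Real.log (N / s) ≤ (N / s : ℝ) ^ (2 / 3 : ℝ) / (2 / 3) :=
      Real.log_le_rpow_div (by positivity) (by norm_num)
    rw [Real.div_rpow (by positivity) (by positivity)] at h1
    have hps : 0 < s ^ (2 / 3 : ℝ) := by positivity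
    have hmono : s ^ (2 / 3 : ℝ) ≤ (N : ℝ) ^ (2 / 3 : ℝ) := by gcongr
    have h2 : s ^ (2 / 3 : ℝ) * Real.log (N / s) ≤ 3 / 2 * (N : ℝ) ^ (2 / 3 : ℝ) := by
      calc _ ≤ s ^ (2 / 3 : ℝ) * ((N : ℝ) ^ (2 / 3 : ℝ) / s ^ (2 / 3 : ℝ) / (2 / 3)) := by gcongr
        _ = _ := by field_simp
    rw [e, mul_add]
    nlinarith
  have k1 := key t ht1 htN
  have k2 := key 1 le_rfl (ht1.trans htN)
  have hl4 : Real.log (4 * 1) ≤ 2 := by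
    rw [mul_one, Real.log_le_iff_le_exp (by norm_num)]
    have := Real.add_one_le_exp (1 : ℝ)
    have e : Real.exp 2 = Real.exp 1 * Real.exp 1 := by rw [← Real.exp_add]; norm_num
    nlinarith
  rw [Real.one_rpow, one_mul] at k2
  have k3 : Real.log (4 * N) ≤ 6 * (N : ℝ) ^ (2 / 3 : ℝ) := by
    have := mul_le_mul_of_nonneg_left hl4 (show 0 ≤ 3 * (N : ℝ) ^ (2 / 3 : ℝ) by positivity)
    linarith
  have hf : (t : ℝ) ^ (2 / 3 : ℝ) / (8 * Real.log (4 * t)) * Real.log (4 * N) ≤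
      3 / 8 * (N : ℝ) ^ (2 / 3 : ℝ) := by
    rw [div_mul_eq_mul_div, div_le_iff₀ (by linarith)]
    linarith
  have hf0 := polyRate_aux_nonneg t
  unfold polyRate
  rw [div_le_div_iff₀ (by positivity) (by positivity)]
  linarith

theorem le_sum_polyRate (N : ℕ) :
    (N : ℝ) ^ (1 / 3 : ℝ) * Real.log (4 * N) / 7 ≤ ∑ i ∈ Finset.range N, polyRate (i + 1) := by
  rcases Nat.eq_zero_or_pos N with rfl | hN
  · simp
  have hN' : (0 : ℝ) < N := by exact_mod_cast hN
  have := Finset.card_nsmul_le_sum (Finset.range N) (fun i => polyRate (i + 1))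
    (Real.log (4 * N) / (7 * (N : ℝ) ^ (2 / 3 : ℝ))) fun i hi =>
      le_polyRate (by omega) (by have := Finset.mem_range.1 hi; omega)
  refine le_trans (le_of_eq ?_) this
  have e : (N : ℝ) = (N : ℝ) ^ (1 / 3 : ℝ) * (N : ℝ) ^ (2 / 3 : ℝ) := by
    rw [← Real.rpow_add hN']; norm_num
  rw [Finset.card_range, nsmul_eq_mul]
  have : 0 < (N : ℝ) ^ (2 / 3 : ℝ) := by positivity
  field_simp
  linear_combination -Real.log (4 * N) * e

/-- The influence of the initial estimate is negligible after one epoch. -/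
theorem prod_one_sub_polyRate_le {c γ : ℝ} (hc : 0 < c) {N : ℕ} (hN : 1 ≤ N)
    (hγ : c * Real.log (4 * N) / (N : ℝ) ^ (1 / 3 : ℝ) ≤ 1 - γ) (hγ1 : γ ∈ Set.Icc (0 : ℝ) 1) :
    ∏ i ∈ Finset.range N, (1 - polyRate (i + 1) * (1 - γ)) ≤
      Real.exp (7 / (36 * c)) / (N : ℝ) ^ (1 / 3 : ℝ) := by
  have hN' : (1 : ℝ) ≤ N := by exact_mod_cast hN
  set l := Real.log (4 * N) with hl
  have hl1 := one_lt_log_four_mul hN'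
  have hp : 0 < (N : ℝ) ^ (1 / 3 : ℝ) := by positivity
  have h1 : ∏ i ∈ Finset.range N, (1 - polyRate (i + 1) * (1 - γ)) ≤
      Real.exp (-((1 - γ) * ∑ i ∈ Finset.range N, polyRate (i + 1))) := by
    rw [Finset.mul_sum, ← Finset.sum_neg_distrib, Real.exp_sum]
    refine Finset.prod_le_prod (fun i _ => ?_) fun i _ => ?_
    · have := polyRate_mem_Ioc (i + 1)
      nlinarith [this.1, this.2, hγ1.1, hγ1.2]
    · rw [mul_comm]
      exact Real.one_sub_le_exp_neg _
  have h2 : c * l ^ 2 / 7 ≤ (1 - γ) * ∑ i ∈ Finset.range N, polyRate (i + 1) := by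
    calc c * l ^ 2 / 7 = (c * l / (N : ℝ) ^ (1 / 3 : ℝ)) * ((N : ℝ) ^ (1 / 3 : ℝ) * l / 7) := by
          field_simp
      _ ≤ _ := by
          have := le_sum_polyRate N
          gcongr
          exact sub_nonneg.2 hγ1.2
  -- Completing the square: 7/(36c) is the maximum of l/3 - c l²/7 over l. The quadratic exponent
  -- thus beats the l/3 needed for N^{-1/3}.
  have h3 : -(c * l ^ 2 / 7) ≤ 7 / (36 * c) + -(1 / 3 * l) := by
    have e : 7 / (36 * c) + -(1 / 3 * l) + c * l ^ 2 / 7 = (6 * c * l - 7) ^ 2 / (252 * c) := by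
      field_simp; ring
    have : 0 ≤ (6 * c * l - 7) ^ 2 / (252 * c) := by positivity
    linarith
  have h4 : Real.exp (-(1 / 3 * l)) ≤ 1 / (N : ℝ) ^ (1 / 3 : ℝ) := by
    rw [Real.exp_neg, ← one_div]
    refine one_div_le_one_div_of_le hp ?_
    rw [mul_comm, hl, ← Real.rpow_def_of_pos (by positivity)]
    gcongr
    linarith
  calc _ ≤ _ := h1
    _ ≤ Real.exp (7 / (36 * c) + -(1 / 3 * l)) := Real.exp_le_exp.2 (by linarith)
    _ = Real.exp (7 / (36 * c)) * Real.exp (-(1 / 3 * l)) := Real.exp_add _ _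
    _ ≤ Real.exp (7 / (36 * c)) * (1 / (N : ℝ) ^ (1 / 3 : ℝ)) := by gcongr
    _ = _ := by ring

/-! ### The union bound and one epoch of the first schedule. -/

namespace FiniteMDP

section

variable {S : Type u} {A : Type v} [Fintype S] [MeasurableSpace S] [DiscreteMeasurableSpace S]
  [Fintype A] {Ω : Type w} [MeasurableSpace Ω] {μ : Measure Ω} {M : FiniteMDP S A}
  {X : ℕ → ℕ → S → A → Ω → S} {g : S → ℝ} {H : ℝ} {η : ℕ → ℕ → ℝ}

/-- Union bound for the averaged noise over finitely many epochs and iterations. -/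
theorem IsGenerativeModel.one_sub_le_of_noiseAvg_le [IsProbabilityMeasure μ]
    (hX : M.IsGenerativeModel μ X) (hg : ∀ s, g s ∈ Set.Icc 0 H) (hH : 0 < H)
    (hη : ∀ k t, η k t ∈ Set.Ioc (0 : ℝ) 1)
    (hstep : ∀ k t, (1 - η k (t + 1)) * η k t ≤ η k (t + 1))
    {I : Finset (ℕ × ℕ)} {L : ℕ × ℕ → ℝ} (hL : ∀ i ∈ I, 0 ≤ L i) {δ : ℝ}
    (hδ : ∑ i ∈ I, Fintype.card S * Fintype.card A * (2 * Real.exp (-L i)) ≤ δ) {E : Set Ω}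
    (hE : ∀ ω, (∀ i ∈ I, ∀ s a,
      |M.noiseAvg g (η i.1) (fun t s a => X i.1 t s a ω) i.2 s a| ≤
        H * Real.sqrt (η i.1 i.2 * L i)) → ω ∈ E) : 1 - δ ≤ μ.real E := by
  refine one_sub_le_measureReal_of_compl_subset (I := I ×ˢ (Finset.univ : Finset (S × A)))
    (t := fun j => {ω | H * Real.sqrt (η j.1.1 j.1.2 * L j.1) ≤
      |M.noiseAvg g (η j.1.1) (fun t s a => X j.1.1 t s a ω) j.1.2 j.2.1 j.2.2|}) ?_ ?_
  · intro ω hω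
    by_contra hcon
    refine hω (hE ω fun i hi s a => ?_)
    by_contra hlt
    refine hcon (Set.mem_iUnion₂.2 ⟨(i, (s, a)), ?_, (not_le.1 hlt).le⟩)
    simpa using hi
  · refine le_trans ?_ hδ
    rw [Finset.sum_product]
    refine Finset.sum_le_sum fun i hi => ?_
    refine (Finset.sum_le_sum fun j _ => hX.measure_noiseAvg_ge_le hg hH (hη i.1) (hstep i.1)
      (hL i hi) i.1 i.2 j.1 j.2).trans (le_of_eq ?_)
    rw [Finset.sum_const, Finset.card_univ, Fintype.card_prod, nsmul_eq_mul, Nat.cast_mul]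

end

section

variable {S : Type u} {A : Type v} [Fintype S] [DecidableEq S] [Fintype A] {M : FiniteMDP S A}

theorem finalError_le_iff {Ω : Type*} {p : Schedule} {X : ℕ → ℕ → S → A → Ω → S} {K : ℕ} {ω : Ω}
    {R : ℝ} (hR : 0 ≤ R) : M.finalError p X K ω ≤ R ↔
      ∀ s a, |M.finalQ p (fun k t s a => X k t s a ω) K s a - M.optimalGain| ≤ R := by
  rw [finalError, pi_norm_le_iff_of_nonneg hR]
  simp [Prod.forall]

end

/-- Gives SA ≥ 2, which keeps log(SA/δ), hence the epoch lengths of the second schedule, away from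
0. -/
theorem two_le_card_of_spanNorm_pos {S : Type u} [Fintype S] [Nonempty S] {h : S → ℝ}
    (hh : 0 < spanNorm h) : 2 ≤ Fintype.card S := by
  by_contra hcon
  have : Subsingleton S := Fintype.card_le_one_iff_subsingleton.1 (by omega)
  obtain ⟨s⟩ := ‹Nonempty S›
  have e : h = fun _ => h s := funext fun s' => by rw [Subsingleton.elim s' s]
  rw [spanNorm, e, ciSup_const, ciInf_const] at hh
  simp at hh

/-- The error after one epoch of the first schedule, on the event that the noise is small. -/
theorem BellmanPair.abs_epochQ_polyRate_sub_le {S : Type u} {A : Type v} [Fintype S] [Nonempty S]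
    [Finite A] [Nonempty A] {M : FiniteMDP S A} {J H : ℝ} {g : S → ℝ} (hM : M.BellmanPair J g H)
    {c₀ c₁ c₂ : ℝ} (hc₀ : 0 < c₀) (hc₁ : 0 < c₁) (hc₂ : 0 < c₂) (q : ℕ) (hH : c₀ ≤ H) {γ : ℝ}
    (hγ : γ ∈ Set.Icc (0 : ℝ) 1) {N : ℕ} (hN : 1000 ≤ N)
    (hγ₁ : c₁ * Real.log (4 * N) / (N : ℝ) ^ (1 / 3 : ℝ) ≤ 1 - γ)
    (hγ₂ : 1 - γ ≤ c₂ * Real.log (4 * N) ^ q / (N : ℝ) ^ (1 / 3 : ℝ))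
    {x : ℕ → S → A → S} {Q₀ : S → A → ℝ} {B : ℝ} (hQ : ∀ s a, |Q₀ s a| ≤ B)
    {r : ℝ} (hr : 1 ≤ r)
    (hz : ∀ t ≤ N, ∀ s a, |M.noiseAvg g polyRate x t s a| ≤
      H * Real.sqrt (polyRate t * Real.log (4 * (r * N)))) (s : S) (a : A) :
    |M.epochQ .latest γ polyRate x Q₀ N s a - J| ≤
      (c₂ * 2 ^ q * (1 / c₀ + 4100) + Real.exp (7 / (36 * c₁)) * ((B + 2) / c₀ + 1)) *
        Real.log (r * N) ^ (q + 4) * (H / (N : ℝ) ^ (1 / 3 : ℝ)) := by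
  have hN' : (1000 : ℝ) ≤ N := by exact_mod_cast hN
  have hN0 : (0 : ℝ) < N := by linarith
  have hH0 : 0 < H := hc₀.trans_le hH
  have hγ' : 0 ≤ 1 - γ := sub_nonneg.2 hγ.2
  set l := Real.log (r * N) with hl
  have hNr : (N : ℝ) ≤ r * N := le_mul_of_one_le_left hN0.le hr
  have hlogN : Real.log N ≤ l := Real.log_le_log hN0 hNr
  have hexp2 : Real.exp 2 ≤ 9 := by
    have e : Real.exp 2 = Real.exp 1 * Real.exp 1 := by rw [← Real.exp_add]; norm_num
    nlinarith [Real.exp_one_lt_d9, Real.exp_pos 1]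
  have hl2 : 2 ≤ l := by
    refine le_trans ?_ hlogN
    rw [Real.le_log_iff_exp_le hN0]
    linarith
  have hlog4 : Real.log 4 ≤ 2 := by
    rw [Real.log_le_iff_le_exp (by norm_num)]
    have := Real.add_one_le_exp (1 : ℝ)
    have e : Real.exp 2 = Real.exp 1 * Real.exp 1 := by rw [← Real.exp_add]; norm_num
    nlinarith
  have hlog4N : Real.log (4 * N) ≤ 2 * l := by
    rw [Real.log_mul (by norm_num) hN0.ne']; linarith
  have hL : Real.log (4 * (r * N)) ≤ 2 * l := by
    rw [Real.log_mul (by norm_num) (by positivity)]; linarith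
  have hL1 : 1 < Real.log (4 * (r * N)) := one_lt_log_four_mul (by linarith)
  have hsL : Real.sqrt (Real.log (4 * (r * N))) ≤ 2 * l := by
    refine (Real.sqrt_le_iff.2 ⟨by linarith, ?_⟩).trans hL
    nlinarith
  have hl4N := one_lt_log_four_mul (t := N) (by linarith)
  set w := (N : ℝ) ^ (1 / 3 : ℝ) with hw
  have hw0 : 0 < w := by positivity
  have hJ := hM.gain_mem_Icc
  have hw1 : 1 ≤ w := Real.one_le_rpow (by linarith) (by norm_num)
  have hB0 : 0 ≤ B := (abs_nonneg _).trans (hQ s a)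
  have hγle : 1 - γ ≤ 1 := by linarith [hγ.1]
  have hrefJ := fun s a => hM.abs_refQ_sub_le hγ.2 s a
  -- A crude bound suffices, since the epoch multiplies it by O(N^{-1/3}).
  have he : ∀ s a, |Q₀ s a - M.refQ J g γ s a| ≤ B + 2 + H := by
    intro s a
    have h1 := abs_le.1 (hQ s a)
    have h2 := abs_le.1 (hrefJ s a)
    have h3 : (1 - γ) * (1 + H) ≤ 1 + H := mul_le_of_le_one_left (by linarith) hγle
    rw [abs_le]
    constructor <;> linarith [hJ.1, hJ.2]
  have main := hM.abs_epochQ_latest_sub_le (x := x) hγ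
    (fun t => Set.Ioc_subset_Icc_self (polyRate_mem_Ioc t)) he
    (fun t (ht : t < N) => hz t ht.le) hH0.le le_rfl s a
  have hprod := prod_one_sub_polyRate_le hc₁ (by omega) hγ₁ hγ
  rw [← hw] at hprod
  have hT1 := hrefJ s a
  have hT2 : |γ * (1 - γ) * M.noiseAvg g polyRate x N s a| ≤ (1 - γ) * (H * (2 * l)) := by
    rw [abs_mul, abs_of_nonneg (mul_nonneg hγ.1 hγ')]
    have hsq : Real.sqrt (polyRate N * Real.log (4 * (r * N))) ≤ 2 * l :=
      (Real.sqrt_le_sqrt (mul_le_of_le_one_left (by linarith) (polyRate_mem_Ioc N).2)).trans hsL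
    have := (hz N le_rfl s a).trans (mul_le_mul_of_nonneg_left hsq hH0.le)
    exact mul_le_mul (mul_le_of_le_one_left hγ' hγ.2) this (abs_nonneg _) hγ'
  have hT4 : ∑ i ∈ Finset.range N, polyRate (i + 1) *
      (H * Real.sqrt (polyRate i * Real.log (4 * (r * N)))) ≤ H * (4096 * l ^ 4) := by
    have e : ∀ i ∈ Finset.range N, polyRate (i + 1) *
        (H * Real.sqrt (polyRate i * Real.log (4 * (r * N)))) =
        H * Real.sqrt (Real.log (4 * (r * N))) * (polyRate (i + 1) * Real.sqrt (polyRate i)) := by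
      intro i _
      rw [Real.sqrt_mul (polyRate_mem_Ioc i).1.le]
      ring
    rw [Finset.sum_congr rfl e, ← Finset.mul_sum]
    have hb : (16 * Real.log (4 * N)) ^ 2 * (1 + Real.log N) ≤ (16 * (2 * l)) ^ 2 * (2 * l) := by
      have : 0 ≤ Real.log N := Real.log_nonneg (by linarith)
      gcongr
      linarith
    calc _ ≤ H * (2 * l) * ((16 * (2 * l)) ^ 2 * (2 * l)) :=
          mul_le_mul (mul_le_mul_of_nonneg_left hsL hH0.le) (sum_polyRate_mul_sqrt_le.trans hb)
            (Finset.sum_nonneg fun i _ => mul_nonneg (polyRate_mem_Ioc _).1.le (Real.sqrt_nonneg _))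
            (by positivity)
      _ = _ := by ring
  have htot : |M.epochQ .latest γ polyRate x Q₀ N s a - J| ≤
      (1 - γ) * (1 + H) + (1 - γ) * (H * (2 * l)) +
      (Real.exp (7 / (36 * c₁)) / w * (B + 2 + H) + (1 - γ) * (H * (4096 * l ^ 4)) +
        (1 - γ) * H) := by
    have m1 := mul_le_mul_of_nonneg_right hprod (show 0 ≤ B + 2 + H by positivity)
    have m2 := mul_le_mul_of_nonneg_left hT4 hγ'
    have m3 := abs_le.1 main
    have m4 := abs_le.1 hT1
    have m5 := abs_le.1 hT2
    rw [abs_le]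
    constructor <;> linarith
  refine htot.trans ?_
  have hl1 : 1 ≤ l := by linarith
  have hl14 : l ≤ l ^ 4 := le_self_pow₀ hl1 (by norm_num)
  have h1l4 : 1 ≤ l ^ 4 := one_le_pow₀ hl1
  have h1H : 1 ≤ H * (1 / c₀) := by rw [mul_one_div, one_le_div hc₀]; exact hH
  -- 4100 = 1 + 2 + 4096 + 1, and 1/c₀ pays for the summand 1 through H ≥ c₀.
  have hbr : (1 + H) + H * (2 * l) + H * (4096 * l ^ 4) + H ≤ H * (l ^ 4 * (1 / c₀ + 4100)) := by
    have a1 : 1 ≤ H * (1 / c₀) * l ^ 4 := one_le_mul_of_one_le_of_one_le h1H h1l4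
    have a2 := mul_le_mul_of_nonneg_left hl14 hH0.le
    have a3 := mul_le_mul_of_nonneg_left h1l4 hH0.le
    linarith
  have hG : 1 - γ ≤ c₂ * 2 ^ q * l ^ q / w := by
    refine hγ₂.trans ?_
    rw [mul_assoc, ← mul_pow]
    gcongr
  have hE0 := Real.exp_pos (7 / (36 * c₁))
  have t1 := mul_le_mul hG hbr (by positivity) (by positivity)
  have hB2 : B + 2 + H ≤ H * ((B + 2) / c₀ + 1) := by
    have : B + 2 ≤ (B + 2) * (H * (1 / c₀)) := le_mul_of_one_le_right (by linarith) h1H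
    calc B + 2 + H ≤ (B + 2) * (H * (1 / c₀)) + H := by linarith
      _ = _ := by ring
  have hlq : 1 ≤ l ^ (q + 4) := one_le_pow₀ hl1
  have t2 : Real.exp (7 / (36 * c₁)) / w * (B + 2 + H) ≤
      Real.exp (7 / (36 * c₁)) / w * (H * ((B + 2) / c₀ + 1)) * l ^ (q + 4) :=
    (mul_le_mul_of_nonneg_left hB2 (by positivity)).trans
      (le_mul_of_one_le_right (by positivity) hlq)
  calc _ = (1 - γ) * ((1 + H) + H * (2 * l) + H * (4096 * l ^ 4) + H) +
        Real.exp (7 / (36 * c₁)) / w * (B + 2 + H) := by ring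
    _ ≤ c₂ * 2 ^ q * l ^ q / w * (H * (l ^ 4 * (1 / c₀ + 4100))) +
        Real.exp (7 / (36 * c₁)) / w * (H * ((B + 2) / c₀ + 1)) * l ^ (q + 4) := add_le_add t1 t2
    _ = _ := by rw [pow_add]; ring

/-! ### Boundedness of the iterates and the error bound for the first schedule. -/

theorem thousand_le_firstN (k : ℕ) : 1000 ≤ firstN k := le_max_left _ _

theorem firstN_mono : Monotone firstN := fun _ _ h =>
  max_le_max le_rfl (Nat.pow_le_pow_right (by norm_num) h)

theorem tendsto_firstN : Tendsto (fun k => (firstN k : ℝ)) atTop atTop := by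
  refine tendsto_atTop_mono (fun k => ?_)
    (tendsto_pow_atTop_atTop_of_one_lt (show (1 : ℝ) < 2 by norm_num))
  have : 2 ^ k ≤ firstN k := le_max_right _ _
  exact_mod_cast this

/-- The upper bound on 1-γ_k may exceed 1 in early epochs, so γ_k may be negative there. From an
epoch depending only on c and q on, γ_k ≥ 0, and the convexity argument applies. -/
theorem eventually_mul_log_pow_div_le_one {c : ℝ} (hc : 0 < c) (q : ℕ) :
    ∃ k₀ : ℕ, ∀ k ≥ k₀,
      c * Real.log (4 * firstN k) ^ q / (firstN k : ℝ) ^ (1 / 3 : ℝ) ≤ 1 := by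
  have h1 := (isLittleO_log_rpow_rpow_atTop (q : ℝ) (show (0 : ℝ) < 1 / 3 by norm_num)).def
    (show 0 < 1 / (2 * c) by positivity)
  have h2 : Tendsto (fun k => 4 * (firstN k : ℝ)) atTop atTop :=
    tendsto_firstN.const_mul_atTop (by norm_num)
  obtain ⟨k₀, hk₀⟩ := eventually_atTop.1 (h2.eventually h1)
  refine ⟨k₀, fun k hk => ?_⟩
  have hN : (1000 : ℝ) ≤ firstN k := by exact_mod_cast thousand_le_firstN k
  have hl := one_lt_log_four_mul (t := firstN k) (by linarith)
  have h3 := hk₀ k hk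
  rw [Real.rpow_natCast, Real.norm_of_nonneg (by positivity),
    Real.norm_of_nonneg (by positivity), Real.mul_rpow (by norm_num) (by positivity)] at h3
  have h4 : (4 : ℝ) ^ (1 / 3 : ℝ) ≤ 2 := by
    calc (4 : ℝ) ^ (1 / 3 : ℝ) ≤ 4 ^ (1 / 2 : ℝ) :=
          Real.rpow_le_rpow_of_exponent_le (by norm_num) (by norm_num)
      _ = 2 := by
        rw [← Real.sqrt_eq_rpow, show (4 : ℝ) = 2 ^ 2 by norm_num, Real.sqrt_sq (by norm_num)]
  have hp : 0 < (firstN k : ℝ) ^ (1 / 3 : ℝ) := by positivity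
  rw [div_le_one hp]
  calc _ ≤ c * (1 / (2 * c) * (4 ^ (1 / 3 : ℝ) * (firstN k : ℝ) ^ (1 / 3 : ℝ))) := by gcongr
    _ ≤ c * (1 / (2 * c) * (2 * (firstN k : ℝ) ^ (1 / 3 : ℝ))) := by gcongr
    _ = _ := by field_simp

/-- A bound for the estimates of the first schedule in the epochs before the discount factors
become nonnegative. -/
noncomputable def growthBound (c : ℝ) (q : ℕ) : ℕ → ℝ
  | 0 => 1
  | k + 1 => growthBound c q k *
      (2 + 2 * (c * Real.log (4 * firstN (k + 1)) ^ q)) ^ firstN (k + 1)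

theorem one_le_growth_factor {c : ℝ} (hc : 0 < c) (q k : ℕ) :
    1 ≤ (2 + 2 * (c * Real.log (4 * firstN k) ^ q)) ^ firstN k := by
  have hN : (1000 : ℝ) ≤ firstN k := by exact_mod_cast thousand_le_firstN k
  have hl := one_lt_log_four_mul (t := firstN k) (by linarith)
  have : 0 ≤ c * Real.log (4 * firstN k) ^ q := by positivity
  exact one_le_pow₀ (by linarith)

theorem one_le_growthBound {c : ℝ} (hc : 0 < c) (q k : ℕ) : 1 ≤ growthBound c q k := by
  induction k with
  | zero => exact le_rfl
  | succ k ih => exact one_le_mul_of_one_le_of_one_le ih (one_le_growth_factor hc q (k + 1))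

theorem growthBound_mono {c : ℝ} (hc : 0 < c) (q : ℕ) : Monotone (growthBound c q) :=
  monotone_nat_of_le_succ fun k => le_mul_of_one_le_right
    (by linarith [one_le_growthBound hc q k]) (one_le_growth_factor hc q (k + 1))

variable {S : Type u} {A : Type v} [Fintype S]

theorem abs_finalQ_firstSchedule_le_growthBound [Finite A] [Nonempty A] (M : FiniteMDP S A) {c : ℝ}
    (hc : 0 < c) (q : ℕ) {γ : ℕ → ℝ} (hγ : ∀ k, 1 ≤ k → 0 ≤ 1 - γ k ∧
      1 - γ k ≤ c * Real.log (4 * firstN k) ^ q / (firstN k : ℝ) ^ (1 / 3 : ℝ))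
    (x : ℕ → ℕ → S → A → S) (k : ℕ) (s : S) (a : A) :
    |M.finalQ (firstSchedule γ) x k s a| ≤ growthBound c q k := by
  induction k generalizing s a with
  | zero => simp [finalQ, growthBound]
  | succ k ih =>
    obtain ⟨h1, h2⟩ := hγ (k + 1) (by omega)
    have hN : (1000 : ℝ) ≤ firstN (k + 1) := by exact_mod_cast thousand_le_firstN (k + 1)
    have hl := one_lt_log_four_mul (t := firstN (k + 1)) (by linarith)
    refine abs_epochQ_latest_le_pow (γ := γ (k + 1)) (η := polyRate) ?_
      (fun t => Set.Ioc_subset_Icc_self (polyRate_mem_Ioc t)) (one_le_growthBound hc q k) ih _ s a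
    rw [abs_of_nonneg h1]
    exact h2.trans (div_le_self (by positivity) (Real.one_le_rpow (by linarith) (by norm_num)))

theorem abs_finalQ_firstSchedule_le [Finite A] [Nonempty A] (M : FiniteMDP S A) {c : ℝ}
    (hc : 0 < c) (q : ℕ) {γ : ℕ → ℝ} (hγ : ∀ k, 1 ≤ k → 0 ≤ 1 - γ k ∧
      1 - γ k ≤ c * Real.log (4 * firstN k) ^ q / (firstN k : ℝ) ^ (1 / 3 : ℝ)) {k₀ : ℕ}
    (hk₀ : ∀ k ≥ k₀, c * Real.log (4 * firstN k) ^ q / (firstN k : ℝ) ^ (1 / 3 : ℝ) ≤ 1)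
    (x : ℕ → ℕ → S → A → S) (k : ℕ) (s : S) (a : A) :
    |M.finalQ (firstSchedule γ) x k s a| ≤ growthBound c q k₀ := by
  rcases le_total k k₀ with hk | hk
  · exact (M.abs_finalQ_firstSchedule_le_growthBound hc q hγ x k s a).trans
      (growthBound_mono hc q hk)
  · induction k, hk using Nat.le_induction generalizing s a with
    | base => exact M.abs_finalQ_firstSchedule_le_growthBound hc q hγ x k₀ s a
    | succ k hk ih =>
      obtain ⟨h1, h2⟩ := hγ (k + 1) (by omega)
      have h3 := hk₀ (k + 1) (by omega)
      exact abs_epochQ_le (γ := γ (k + 1)) (η := polyRate) _ ⟨by linarith, by linarith⟩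
        (fun t => Set.Ioc_subset_Icc_self (polyRate_mem_Ioc t)) (one_le_growthBound hc q k₀) ih _
        s a

theorem exists_firstSchedule_error_bound {c₀ c₁ c₂ : ℝ} (hc₀ : 0 < c₀) (hc₁ : 0 < c₁)
    (hc₂ : 0 < c₂) (q : ℕ) : ∃ C : ℝ, 0 < C ∧ ∃ p : ℕ,
      ∀ (S : Type u) (A : Type v) [Fintype S] [DecidableEq S] [Nonempty S]
        [MeasurableSpace S] [DiscreteMeasurableSpace S] [Fintype A] [Nonempty A]
        (M : FiniteMDP S A) (h : S → ℝ), M.IsOptimalBias h → c₀ ≤ spanNorm h →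
      ∀ γ : ℕ → ℝ,
        (∀ k : ℕ, 1 ≤ k →
          c₁ * Real.log (4 * firstN k) / (firstN k : ℝ) ^ (1 / 3 : ℝ) ≤ 1 - γ k ∧
            1 - γ k ≤ c₂ * Real.log (4 * firstN k) ^ q / (firstN k : ℝ) ^ (1 / 3 : ℝ)) →
      ∀ (Ω : Type w) [MeasurableSpace Ω] (μ : Measure Ω) [IsProbabilityMeasure μ]
        (X : ℕ → ℕ → S → A → Ω → S), M.IsGenerativeModel μ X →
      ∀ δ : ℝ, 0 < δ → δ < 1 → ∀ K : ℕ, 1 ≤ K →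
        1 - δ ≤ μ.real {ω | M.finalError (firstSchedule γ) X K ω ≤
          C * Real.log (Fintype.card S * Fintype.card A * firstN K / δ) ^ p *
            (spanNorm h / (firstN K : ℝ) ^ (1 / 3 : ℝ))} := by
  obtain ⟨k₀, hk₀⟩ := eventually_mul_log_pow_div_le_one hc₂ q
  set B := growthBound c₂ q k₀ with hB
  have hB1 : 1 ≤ B := one_le_growthBound hc₂ q k₀
  set C₁ := (B + 1) * (firstN k₀ : ℝ) ^ (1 / 3 : ℝ) / c₀ with hC₁
  set C₂ := c₂ * 2 ^ q * (1 / c₀ + 4100) + Real.exp (7 / (36 * c₁)) * ((B + 2) / c₀ + 1) with hC₂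
  have hC₁0 : 0 ≤ C₁ := by positivity
  have hC₂0 : 0 < C₂ := by positivity
  refine ⟨C₁ + C₂, by positivity, q + 4, ?_⟩
  intro S A _ _ _ _ _ _ _ M h hh hspan γ hγ Ω _ μ _ X hX δ hδ0 hδ1 K hK
  have hM := hh.bellmanPair
  have hJ := hM.gain_mem_Icc
  set H := spanNorm h
  have hH0 : 0 < H := hc₀.trans_le hspan
  have hγ' : ∀ k, 1 ≤ k → 0 ≤ 1 - γ k ∧
      1 - γ k ≤ c₂ * Real.log (4 * firstN k) ^ q / (firstN k : ℝ) ^ (1 / 3 : ℝ) := by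
    intro k hk
    have hN : (1000 : ℝ) ≤ firstN k := by exact_mod_cast thousand_le_firstN k
    have hl := one_lt_log_four_mul (t := firstN k) (by linarith)
    exact ⟨le_trans (by positivity) (hγ k hk).1, (hγ k hk).2⟩
  have hQ := fun x k s a => M.abs_finalQ_firstSchedule_le hc₂ q hγ' hk₀ x k s a
  have hN : (1000 : ℝ) ≤ firstN K := by exact_mod_cast thousand_le_firstN K
  have hN0 : (0 : ℝ) < firstN K := by linarith
  have hm : (1 : ℝ) ≤ Fintype.card S * Fintype.card A := by
    exact_mod_cast Nat.mul_pos Fintype.card_pos Fintype.card_pos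
  set r : ℝ := Fintype.card S * Fintype.card A / δ with hr
  have hr1 : 1 ≤ r := by rw [hr, one_le_div hδ0]; linarith
  have hNr : (firstN K : ℝ) ≤ r * firstN K := le_mul_of_one_le_left hN0.le hr1
  have hrw : (Fintype.card S * Fintype.card A * firstN K / δ : ℝ) = r * firstN K := by
    rw [hr]; ring
  rw [hrw]
  have hl1 : 1 ≤ Real.log (r * firstN K) := by
    rw [Real.le_log_iff_exp_le (by linarith)]
    linarith [Real.exp_one_lt_d9]
  have hlp : 1 ≤ Real.log (r * firstN K) ^ (q + 4) := one_le_pow₀ hl1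
  have hw : 0 < (firstN K : ℝ) ^ (1 / 3 : ℝ) := by positivity
  have hR : 0 ≤ (C₁ + C₂) * Real.log (r * firstN K) ^ (q + 4) *
      (H / (firstN K : ℝ) ^ (1 / 3 : ℝ)) := by positivity
  -- For K < k₀ the deterministic bound B + 1 already suffices: N_K is at most N_{k₀}, and C₁ is
  -- chosen for this.
  rcases lt_or_ge K k₀ with hKk | hKk
  · have huniv : {ω | M.finalError (firstSchedule γ) X K ω ≤
        (C₁ + C₂) * Real.log (r * firstN K) ^ (q + 4) *
          (H / (firstN K : ℝ) ^ (1 / 3 : ℝ))} = Set.univ := by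
      refine Set.eq_univ_of_forall fun ω => (finalError_le_iff hR).2 fun s a => ?_
      have h1 : |M.finalQ (firstSchedule γ) (fun k t s a => X k t s a ω) K s a -
          M.optimalGain| ≤ B + 1 := by
        refine (abs_sub _ _).trans (add_le_add (hQ _ _ _ _) ?_)
        rw [abs_of_nonneg hJ.1]; exact hJ.2
      have hmono : (firstN K : ℝ) ^ (1 / 3 : ℝ) ≤ (firstN k₀ : ℝ) ^ (1 / 3 : ℝ) := by
        have := firstN_mono hKk.le
        gcongr
      refine h1.trans ?_
      calc B + 1 = (B + 1) * 1 * 1 := by ring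
        _ ≤ (B + 1) * (H / c₀) *
            ((firstN k₀ : ℝ) ^ (1 / 3 : ℝ) / (firstN K : ℝ) ^ (1 / 3 : ℝ)) := by
            gcongr
            · exact (one_le_div hc₀).2 hspan
            · exact (one_le_div hw).2 hmono
        _ = C₁ * 1 * (H / (firstN K : ℝ) ^ (1 / 3 : ℝ)) := by rw [hC₁]; ring
        _ ≤ _ := by gcongr; linarith
    rw [huniv, probReal_univ]
    linarith
  · obtain ⟨k, rfl⟩ : ∃ k, K = k + 1 := ⟨K - 1, by omega⟩
    obtain ⟨h1, h2⟩ := hγ (k + 1) hK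
    have h3 := hk₀ (k + 1) hKk
    have h4 := (hγ' (k + 1) hK).1
    have hL1 : 1 < Real.log (4 * (r * firstN (k + 1))) := one_lt_log_four_mul (by linarith)
    -- Only the last epoch's noise matters. Each of its N+1 times, including t = 0, costs δ/(2N).
    refine hX.one_sub_le_of_noiseAvg_le (η := fun _ => polyRate) hM.mem_Icc hH0
      (fun _ => polyRate_mem_Ioc) (fun _ => polyRate_step)
      (I := {k + 1} ×ˢ Finset.range (firstN (k + 1) + 1))
      (L := fun _ => Real.log (4 * (r * firstN (k + 1)))) (fun _ _ => by linarith) ?_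
      fun ω hω => ?_
    · rw [Finset.sum_const, Finset.card_product, Finset.card_singleton, Finset.card_range,
        Real.exp_neg, Real.exp_log (by positivity), nsmul_eq_mul]
      have e : ((1 * (firstN (k + 1) + 1) : ℕ) : ℝ) * (Fintype.card S * Fintype.card A *
          (2 * (4 * (r * firstN (k + 1)))⁻¹)) = δ * ((firstN (k + 1) + 1) / (2 * firstN (k + 1))) := by
        rw [hr]; push_cast
        field_simp
        ring
      rw [e]
      refine mul_le_of_le_one_right hδ0.le ?_
      rw [div_le_one (by linarith)]
      linarith
    · refine (finalError_le_iff hR).2 fun s a => ?_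
      refine (hM.abs_epochQ_polyRate_sub_le hc₀ hc₁ hc₂ q hspan ⟨by linarith, by linarith⟩
        (thousand_le_firstN (k + 1)) h1 h2 (hQ _ k) hr1 (fun t ht s a => ?_) s a).trans ?_
      · exact hω (k + 1, t) (by simp; omega) s a
      · exact mul_le_mul_of_nonneg_right (mul_le_mul_of_nonneg_right
          (le_add_of_nonneg_left hC₁0) (by positivity)) (by positivity)

/-! ### Sample complexity of the first schedule. -/

/-- A polylogarithmic factor is absorbed by a large enough cube root. -/
theorem exists_sampleCount_bound {c₀ C : ℝ} (hc₀ : 0 < c₀) (hC : 0 < C) (p : ℕ) :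
    ∃ C' : ℝ, 0 < C' ∧ ∀ m H δ ε : ℝ, 1 ≤ m → c₀ ≤ H → 0 < δ → δ < 1 → 0 < ε → ε ≤ 1 →
      ∃ K₀ : ℕ, 1 ≤ K₀ ∧
        m * ∑ k ∈ Finset.Icc 1 K₀, (firstN k : ℝ) ≤
          C' * Real.log (2 + m * H / (ε * δ)) ^ (3 * p) * (m * (H / ε) ^ 3) ∧
        ∀ K ≥ K₀, C * Real.log (m * firstN K / δ) ^ p *
          (H / (firstN K : ℝ) ^ (1 / 3 : ℝ)) ≤ ε := by
  set D : ℝ := 1 + 2 * |Real.log c₀| + 3 * (1 + p) with hD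
  have hD0 : 0 < D := by positivity
  -- Z depends only on C, c₀ and p. The inequality is needed for all z ≥ Z because the accuracy must
  -- persist for every K ≥ K₀.
  obtain ⟨Z, hZ1, hZ⟩ : ∃ Z : ℝ, 1 ≤ Z ∧ ∀ z ≥ Z, C * (D + 6 * Real.log z) ^ p ≤ z := by
    have h1 := (Real.isLittleO_pow_log_id_atTop (n := p)).def
      (show 0 < 1 / (C * 7 ^ p) by positivity)
    have h2 := Real.tendsto_log_atTop.eventually_ge_atTop D
    obtain ⟨Z, hZ⟩ := eventually_atTop.1 (h1.and h2)
    refine ⟨max 1 Z, le_max_left _ _, fun z hz => ?_⟩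
    obtain ⟨h3, h4⟩ := hZ z ((le_max_right _ _).trans hz)
    have hz1 : 1 ≤ z := (le_max_left _ _).trans hz
    have hlz := Real.log_nonneg hz1
    rw [id, Real.norm_of_nonneg (by positivity), Real.norm_of_nonneg (by positivity)] at h3
    calc C * (D + 6 * Real.log z) ^ p ≤ C * (7 * Real.log z) ^ p := by gcongr; linarith
      _ = C * 7 ^ p * Real.log z ^ p := by rw [mul_pow]; ring
      _ ≤ C * 7 ^ p * (1 / (C * 7 ^ p) * z) := by gcongr
      _ = z := by field_simp
  refine ⟨4008 * (Z ^ 3 + (1 / c₀) ^ 3 * 2 ^ (3 * p)), by positivity, ?_⟩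
  intro m H δ ε hm hH hδ0 hδ1 hε0 hε1
  set x := H / ε with hx
  have hH0 : 0 < H := hc₀.trans_le hH
  have hx0 : 0 < x := by positivity
  have hxc : c₀ ≤ x := by
    rw [hx, le_div_iff₀ hε0]
    nlinarith
  have hmx : m * H / (ε * δ) = m * x / δ := by rw [hx]; field_simp
  rw [hmx]
  set l := Real.log (2 + m * x / δ) with hl
  have hmx0 : 0 < m * x / δ := by positivity
  have hlhalf : 1 / 2 ≤ l := by
    have := Real.log_le_log (by norm_num) (show (2 : ℝ) ≤ 2 + m * x / δ by linarith)
    linarith [Real.log_two_gt_d9]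
  set n := (Z * x * l ^ p) ^ 3 with hn
  have hn0 : 0 ≤ n := by positivity
  -- With K₀ = j+1, 2^{K₀} exceeds n, so N_K ≥ n from K₀ on, and 2^j ≤ n+1 keeps the geometric sum
  -- of lengths O(n+1).
  obtain ⟨j, hj1, hj2⟩ := exists_nat_pow_near (x := n + 1) (y := 2) (by linarith) one_lt_two
  refine ⟨j + 1, by omega, ?_, ?_⟩
  · have hsum : ∑ k ∈ Finset.Icc 1 (j + 1), (firstN k : ℝ) ≤ 2004 * 2 ^ j := by
      have h1 : ∀ k ∈ Finset.Icc 1 (j + 1), (firstN k : ℝ) ≤ 1000 + 2 ^ k := by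
        intro k _
        rw [firstN]; push_cast
        exact max_le (by linarith [pow_pos (two_pos (α := ℝ)) k]) (by linarith)
      have h2 : ∀ j : ℕ, ∑ k ∈ Finset.Icc 1 (j + 1), ((1000 : ℝ) + 2 ^ k) ≤ 2004 * 2 ^ j := by
        intro j
        induction j with
        | zero => norm_num
        | succ j ih =>
          rw [Finset.sum_Icc_succ_top (by omega)]
          have := one_le_pow₀ (M₀ := ℝ) one_le_two (n := j)
          rw [pow_succ _ (j + 1), pow_succ _ j]
          linarith
      exact (Finset.sum_le_sum h1).trans (h2 j)
    have hone : 1 ≤ (1 / c₀) ^ 3 * 2 ^ (3 * p) * (l ^ (3 * p) * x ^ 3) := by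
      have e : (1 / c₀) ^ 3 * 2 ^ (3 * p) * (l ^ (3 * p) * x ^ 3) =
          (x / c₀) ^ 3 * (2 * l) ^ (3 * p) := by rw [mul_pow, div_pow, div_pow]; ring
      rw [e]
      exact one_le_mul_of_one_le_of_one_le (one_le_pow₀ ((one_le_div hc₀).2 hxc))
        (one_le_pow₀ (by linarith))
    calc m * ∑ k ∈ Finset.Icc 1 (j + 1), (firstN k : ℝ) ≤ m * (2004 * (n + 1)) := by
          gcongr; linarith
      _ ≤ m * (2004 * (n + (1 / c₀) ^ 3 * 2 ^ (3 * p) * (l ^ (3 * p) * x ^ 3))) := by gcongr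
      _ ≤ m * (4008 * (n + (1 / c₀) ^ 3 * 2 ^ (3 * p) * (l ^ (3 * p) * x ^ 3))) := by
          gcongr; norm_num
      _ = _ := by rw [hn, mul_pow, mul_pow, ← pow_mul, mul_comm p 3]; ring
  · intro K hK
    have hnN : n ≤ firstN K := by
      have h1 : (2 : ℝ) ^ K ≤ firstN K := by
        have : 2 ^ K ≤ firstN K := le_max_right _ _
        exact_mod_cast this
      have h2 : (2 : ℝ) ^ (j + 1) ≤ 2 ^ K := pow_le_pow_right₀ one_le_two hK
      linarith
    set y := (firstN K : ℝ) ^ (1 / 3 : ℝ) with hy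
    have hN : (1000 : ℝ) ≤ firstN K := by exact_mod_cast thousand_le_firstN K
    have hy0 : 0 < y := by positivity
    have hy3 : (firstN K : ℝ) = y ^ 3 := by
      rw [hy, ← Real.rpow_mul_natCast (by positivity)]; norm_num
    have hZy : Z * x * l ^ p ≤ y := by
      rw [hn, hy3] at hnN
      exact le_of_pow_le_pow_left₀ (by norm_num) hy0.le hnN
    have hxl : 0 < x * l ^ p := by positivity
    -- z measures how far N_K^{1/3} exceeds the scale x l^p. Then log(mN_K/δ) ≤ l (D + 6 log z), so
    -- l^p factors out and the choice of Z closes the bound.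
    set z := y / (x * l ^ p) with hz
    have hyz : y = z * (x * l ^ p) := by rw [hz]; field_simp
    have hZz : Z ≤ z := by rw [hz, le_div_iff₀ hxl]; linarith
    have hz1 : 1 ≤ z := hZ1.trans hZz
    have hlz := Real.log_nonneg hz1
    have hlogx : Real.log x ≤ l := by
      refine Real.log_le_log hx0 ?_
      have : x ≤ m * x / δ := by
        rw [le_div_iff₀ hδ0]
        nlinarith
      linarith
    have hlogl : Real.log l ≤ l := (Real.log_le_sub_one_of_pos (by linarith)).trans (by linarith)
    have hlogmd : Real.log (m / δ) ≤ l + |Real.log c₀| := by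
      have e : m / δ = (m * x / δ) / x := by field_simp
      rw [e, Real.log_div hmx0.ne' hx0.ne']
      have h1 : Real.log (m * x / δ) ≤ l := Real.log_le_log hmx0 (by linarith)
      have h2 : Real.log c₀ ≤ Real.log x := Real.log_le_log hc₀ hxc
      linarith [neg_abs_le (Real.log c₀)]
    have hlogN : Real.log (m * firstN K / δ) ≤ l * (D + 6 * Real.log z) := by
      have e : m * firstN K / δ = m / δ * y ^ 3 := by rw [hy3]; ring
      have e2 : Real.log y = Real.log z + (Real.log x + p * Real.log l) := by
        rw [hyz, Real.log_mul (by positivity) (by positivity),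
          Real.log_mul (by positivity) (by positivity), Real.log_pow]
      rw [e, Real.log_mul (by positivity) (by positivity), Real.log_pow, e2]
      have h1 : (p : ℝ) * Real.log l ≤ p * l := by gcongr
      have h2 : Real.log z ≤ 2 * l * Real.log z := le_mul_of_one_le_left hlz (by linarith)
      have h3 : |Real.log c₀| ≤ 2 * l * |Real.log c₀| :=
        le_mul_of_one_le_left (abs_nonneg _) (by linarith)
      push_cast
      rw [hD]
      linarith
    have hlog0 : 0 ≤ Real.log (m * firstN K / δ) := by
      refine Real.log_nonneg ?_
      rw [one_le_div hδ0]
      nlinarith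
    have hstep : C * Real.log (m * firstN K / δ) ^ p * x ≤ y := by
      calc C * Real.log (m * firstN K / δ) ^ p * x
          ≤ C * (l * (D + 6 * Real.log z)) ^ p * x := by gcongr
        _ = C * (D + 6 * Real.log z) ^ p * (x * l ^ p) := by rw [mul_pow]; ring
        _ ≤ z * (x * l ^ p) := by gcongr; exact hZ z hZz
        _ = y := hyz.symm
    have e3 : C * Real.log (m * firstN K / δ) ^ p * (H / y) =
        ε * (C * Real.log (m * firstN K / δ) ^ p * x / y) := by
      rw [hx]; field_simp
    rw [e3]
    exact mul_le_of_le_one_right hε0.le ((div_le_one hy0).2 hstep)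

/-! ### Rates and error recursion of the second schedule. -/

/-- The constant learning rate of epoch `k` in the second schedule. -/
noncomputable def secondRate (cN δ : ℝ) (m k : ℕ) : ℝ :=
  1 / (1 + (secondN cN δ m k : ℝ) /
    (4 * Real.log (∑ j ∈ Finset.Icc 1 k, (secondN cN δ m j : ℝ))))

theorem log_sum_secondN_nonneg (cN δ : ℝ) (m k : ℕ) :
    0 ≤ Real.log (∑ j ∈ Finset.Icc 1 k, (secondN cN δ m j : ℝ)) := by
  rw [← Nat.cast_sum]
  exact Real.log_natCast_nonneg _

theorem secondRate_mem_Ioc (cN δ : ℝ) (m k : ℕ) : secondRate cN δ m k ∈ Set.Ioc (0 : ℝ) 1 := by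
  have := log_sum_secondN_nonneg cN δ m k
  have h : 0 ≤ (secondN cN δ m k : ℝ) /
    (4 * Real.log (∑ j ∈ Finset.Icc 1 k, (secondN cN δ m j : ℝ))) := by positivity
  exact ⟨by unfold secondRate; positivity, div_le_one_of_le₀ (by linarith) (by positivity)⟩

section Rates

variable {cN δ : ℝ} {m k : ℕ}

theorem log_cast_div_gt (hm : 2 ≤ m) (hδ0 : 0 < δ) (hδ1 : δ < 1) : 0.69 ≤ Real.log (m / δ) := by
  have hm' : (2 : ℝ) ≤ m := by exact_mod_cast hm
  have h : (2 : ℝ) ≤ m / δ := by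
    rw [le_div_iff₀ hδ0]; linarith
  linarith [Real.log_two_gt_d9, Real.log_le_log two_pos h]

theorem log_cast_add_one_gt (hk : 1 ≤ k) : 0.69 ≤ Real.log ((k : ℝ) + 1) := by
  have hk' : (1 : ℝ) ≤ k := by exact_mod_cast hk
  linarith [Real.log_two_gt_d9, Real.log_le_log two_pos (show (2 : ℝ) ≤ k + 1 by linarith)]

theorem le_secondN (hc : 1000 ≤ cN) (hm : 2 ≤ m) (hδ0 : 0 < δ) (hδ1 : δ < 1) (hk : 1 ≤ k) :
    50 * (k : ℝ) ^ 2 ≤ secondN cN δ m k := by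
  have hl := log_cast_div_gt hm hδ0 hδ1
  have ha := log_cast_add_one_gt hk
  refine le_trans ?_ (Nat.le_ceil _)
  -- Both logarithms are at least log 2 > 0.69, and 1000 · 0.69⁸ > 50.
  calc 50 * (k : ℝ) ^ 2 ≤ 1000 * (k : ℝ) ^ 2 * 0.69 ^ 5 * 0.69 ^ 3 := by
        nlinarith [sq_nonneg (k : ℝ)]
    _ ≤ _ := by gcongr

theorem secondN_mono (hc : 1000 ≤ cN) (hm : 2 ≤ m) (hδ0 : 0 < δ) (hδ1 : δ < 1) {j : ℕ}
    (hjk : j ≤ k) : secondN cN δ m j ≤ secondN cN δ m k := by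
  have hl := log_cast_div_gt hm hδ0 hδ1
  have hj : 0 ≤ Real.log ((j : ℝ) + 1) := Real.log_nonneg (by linarith [j.cast_nonneg (α := ℝ)])
  unfold secondN
  gcongr

theorem log_sum_secondN_le (hc : 1000 ≤ cN) (hm : 2 ≤ m) (hδ0 : 0 < δ) (hδ1 : δ < 1)
    (hk : 1 ≤ k) : Real.log (∑ j ∈ Finset.Icc 1 k, (secondN cN δ m j : ℝ)) ≤
      2 * Real.log (secondN cN δ m k) := by
  have hN := le_secondN hc hm hδ0 hδ1 hk
  have hk' : (1 : ℝ) ≤ k := by exact_mod_cast hk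
  have hkN : (k : ℝ) ≤ secondN cN δ m k := by nlinarith
  have hsum : ∑ j ∈ Finset.Icc 1 k, (secondN cN δ m j : ℝ) ≤ k * secondN cN δ m k := by
    have := Finset.sum_le_card_nsmul (Finset.Icc 1 k) (fun j => (secondN cN δ m j : ℝ))
      (secondN cN δ m k) fun j hj => by
        exact_mod_cast secondN_mono hc hm hδ0 hδ1 (Finset.mem_Icc.1 hj).2
    simpa using this
  have hle : (secondN cN δ m k : ℝ) ≤ ∑ j ∈ Finset.Icc 1 k, (secondN cN δ m j : ℝ) :=
    Finset.single_le_sum (f := fun j => (secondN cN δ m j : ℝ)) (fun _ _ => Nat.cast_nonneg _)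
      (Finset.mem_Icc.2 ⟨hk, le_rfl⟩)
  have h2 : (2 : ℝ) * Real.log (secondN cN δ m k) = Real.log ((secondN cN δ m k : ℝ) ^ 2) := by
    rw [Real.log_pow]; norm_num
  rw [h2]
  refine Real.log_le_log (by nlinarith) (hsum.trans ?_)
  rw [sq]
  gcongr

theorem eight_mul_log_le {x : ℝ} (hx : 50 ≤ x) : 8 * Real.log x ≤ x := by
  have e : x = 2 ^ 6 * (x / 64) := by ring
  have h1 := Real.log_le_sub_one_of_pos (show 0 < x / 64 by linarith)
  have h2 : Real.log x = 6 * Real.log 2 + Real.log (x / 64) := by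
    conv_lhs => rw [e]
    rw [Real.log_mul (by norm_num) (by positivity), Real.log_pow]
    norm_num
  linarith [Real.log_two_lt_d9]

/-- With l the logarithm of the total length, l ≤ 2 log N and 8 log N ≤ N give 4l ≤ N. Hence ηN =
4lN/(4l+N) ≥ 2l ≥ 2 log N, and the epoch forgets its start up to 1/N. -/
theorem one_sub_secondRate_pow_le (hc : 1000 ≤ cN) (hm : 2 ≤ m) (hδ0 : 0 < δ) (hδ1 : δ < 1)
    (hk : 1 ≤ k) :
    (1 - secondRate cN δ m k) ^ secondN cN δ m k ≤ 1 / ((k : ℝ) + 1) ^ 2 := by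
  have hN := le_secondN hc hm hδ0 hδ1 hk
  have hk' : (1 : ℝ) ≤ k := by exact_mod_cast hk
  have hη := secondRate_mem_Ioc cN δ m k
  have hls := log_sum_secondN_le hc hm hδ0 hδ1 hk
  have hle : (secondN cN δ m k : ℝ) ≤ ∑ j ∈ Finset.Icc 1 k, (secondN cN δ m j : ℝ) :=
    Finset.single_le_sum (f := fun j => (secondN cN δ m j : ℝ)) (fun _ _ => Nat.cast_nonneg _)
      (Finset.mem_Icc.2 ⟨hk, le_rfl⟩)
  have hN50 : 50 ≤ (secondN cN δ m k : ℝ) := by nlinarith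
  have h8 := eight_mul_log_le hN50
  have hlogN : 0 < Real.log (secondN cN δ m k) := Real.log_pos (by linarith)
  have hlog := Real.log_le_log (by linarith) hle
  have hrate : 2 * Real.log (secondN cN δ m k) ≤ secondRate cN δ m k * secondN cN δ m k := by
    unfold secondRate
    set l := Real.log (∑ j ∈ Finset.Icc 1 k, (secondN cN δ m j : ℝ)) with hl
    set N := (secondN cN δ m k : ℝ)
    have hl0 : 0 < l := hlogN.trans_le hlog
    have e : 1 / (1 + N / (4 * l)) * N = 4 * l * N / (4 * l + N) := by field_simp
    rw [e, le_div_iff₀ (by positivity)]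
    nlinarith
  calc (1 - secondRate cN δ m k) ^ secondN cN δ m k
      ≤ Real.exp (-secondRate cN δ m k) ^ secondN cN δ m k :=
        pow_le_pow_left₀ (by linarith [hη.2]) (Real.one_sub_le_exp_neg _) _
    _ = Real.exp (-(secondRate cN δ m k * secondN cN δ m k)) := by
        rw [← Real.exp_nat_mul]; ring_nf
    _ ≤ Real.exp (-Real.log (secondN cN δ m k)) := Real.exp_le_exp.2 (by linarith)
    _ = 1 / (secondN cN δ m k : ℝ) := by
        rw [Real.exp_neg, Real.exp_log (by linarith), one_div]
    _ ≤ _ := by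
        gcongr
        nlinarith

/-- With a = log(k+1) and l = log(m/δ), the rate is O(1/(k² a⁴ l²)) and the union-bound logarithm
O(a l), uniformly in cN. The spare powers of a and l are bounded below by constants; 190 ≥ √(2240 ·
16). -/
theorem secondRate_mul_log_le (hc : 1000 ≤ cN) (hm : 2 ≤ m) (hδ0 : 0 < δ) (hδ1 : δ < 1)
    (hk : 1 ≤ k) :
    Real.sqrt (secondRate cN δ m k * Real.log (2 * m * k * (k + 1) / δ)) ≤ 190 / k := by
  have hN := le_secondN hc hm hδ0 hδ1 hk
  have hk' : (1 : ℝ) ≤ k := by exact_mod_cast hk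
  have hm' : (2 : ℝ) ≤ m := by exact_mod_cast hm
  have hls := log_sum_secondN_le hc hm hδ0 hδ1 hk
  have hl := log_cast_div_gt hm hδ0 hδ1
  have ha := log_cast_add_one_gt hk
  have hN50 : 50 ≤ (secondN cN δ m k : ℝ) := by nlinarith
  set l := Real.log (m / δ) with hl_def
  set a := Real.log ((k : ℝ) + 1) with ha_def
  have hNlow : cN * (k : ℝ) ^ 2 * a ^ 5 * l ^ 3 ≤ secondN cN δ m k := Nat.le_ceil _
  have hNup : (secondN cN δ m k : ℝ) ≤ 2 * (cN * (k : ℝ) ^ 2 * a ^ 5 * l ^ 3) := by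
    have h1 : (secondN cN δ m k : ℝ) < cN * (k : ℝ) ^ 2 * a ^ 5 * l ^ 3 + 1 :=
      Nat.ceil_lt_add_one (by positivity)
    linarith
  have h1 : 1 ≤ 4 * (a * l) := by nlinarith
  have hal : a ≤ 2 * (a * l) := by nlinarith
  have hla : l ≤ 2 * (a * l) := by nlinarith
  have hlog2 : Real.log 2 ≤ 1 := by linarith [Real.log_two_lt_d9]
  have hlogk : Real.log k ≤ a := Real.log_le_log (by linarith) (by linarith)
  have hlogN : Real.log (secondN cN δ m k) ≤ 28 * (cN * (a * l)) := by
    have e := Real.log_le_log (by linarith) hNup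
    rw [Real.log_mul (by norm_num) (by positivity), Real.log_mul (by positivity) (by positivity),
      Real.log_mul (by positivity) (by positivity), Real.log_mul (by positivity) (by positivity),
      Real.log_pow, Real.log_pow, Real.log_pow] at e
    have e1 : Real.log cN ≤ cN := Real.log_le_self (by linarith)
    have e2 : Real.log a ≤ a := Real.log_le_self (by linarith)
    have e3 : Real.log l ≤ l := Real.log_le_self (by linarith)
    have e4 : cN ≤ 4 * (cN * (a * l)) := by nlinarith
    have e5 : a * l ≤ cN * (a * l) := le_mul_of_one_le_left (by positivity) (by linarith)
    push_cast at e
    linarith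
  have hrate : secondRate cN δ m k ≤ 224 / ((k : ℝ) ^ 2 * a ^ 4 * l ^ 2) := by
    unfold secondRate
    set ls := Real.log (∑ j ∈ Finset.Icc 1 k, (secondN cN δ m j : ℝ)) with hls_def
    have hls0 : 0 ≤ ls := log_sum_secondN_nonneg cN δ m k
    rcases hls0.eq_or_lt with h0 | hpos
    · exfalso
      have hle : (secondN cN δ m k : ℝ) ≤ ∑ j ∈ Finset.Icc 1 k, (secondN cN δ m j : ℝ) :=
        Finset.single_le_sum (f := fun j => (secondN cN δ m j : ℝ))
          (fun _ _ => Nat.cast_nonneg _) (Finset.mem_Icc.2 ⟨hk, le_rfl⟩)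
      have := Real.log_pos (show (1 : ℝ) < ∑ j ∈ Finset.Icc 1 k, (secondN cN δ m j : ℝ) by
        linarith)
      linarith
    · have hNpos : 0 < (secondN cN δ m k : ℝ) := by linarith
      calc 1 / (1 + (secondN cN δ m k : ℝ) / (4 * ls))
          ≤ 1 / ((secondN cN δ m k : ℝ) / (4 * ls)) := by gcongr; linarith
        _ = 4 * ls / secondN cN δ m k := by rw [one_div_div]
        _ ≤ 224 * (cN * (a * l)) / (cN * (k : ℝ) ^ 2 * a ^ 5 * l ^ 3) :=
            div_le_div₀ (by positivity) (by linarith) (by positivity) hNlow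
        _ = _ := by
            have : 0 < cN := by linarith
            have : 0 < a := by linarith
            have : 0 < l := by linarith
            field_simp
  have hL : Real.log (2 * m * k * (k + 1) / δ) ≤ 10 * (a * l) := by
    have e : (2 * m * k * (k + 1) / δ : ℝ) = 2 * (m / δ) * k * (k + 1) := by ring
    rw [e, Real.log_mul (by positivity) (by positivity), Real.log_mul (by positivity)
      (by positivity), Real.log_mul (by norm_num) (by positivity)]
    linarith
  have hL0 : 0 ≤ 10 * (a * l) := by positivity
  refine Real.sqrt_le_iff.2 ⟨by positivity, ?_⟩
  calc _ ≤ 224 / ((k : ℝ) ^ 2 * a ^ 4 * l ^ 2) * (10 * (a * l)) :=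
        mul_le_mul_of_nonneg hrate hL (secondRate_mem_Ioc cN δ m k).1.le hL0
    _ = 2240 / (k : ℝ) ^ 2 * (1 / (a ^ 3 * l)) := by
        have : 0 < a := by linarith
        have : 0 < l := by linarith
        field_simp
        ring
    _ ≤ 2240 / (k : ℝ) ^ 2 * (1 / (0.5 ^ 3 * 0.5)) := by gcongr <;> linarith
    _ ≤ _ := by
        rw [div_pow, ← mul_div_right_comm]
        gcongr
        norm_num

end Rates

variable {S : Type u} {A : Type v} [Fintype S] {M : FiniteMDP S A} {J H : ℝ} {g : S → ℝ}

theorem abs_finalQ_secondSchedule_le [Finite A] [Nonempty A] (M : FiniteMDP S A) (cN δ : ℝ) (m : ℕ)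
    (x : ℕ → ℕ → S → A → S) (k : ℕ) (s : S) (a : A) :
    |M.finalQ (secondSchedule cN δ m) x k s a| ≤ 1 := by
  induction k generalizing s a with
  | zero => simp [finalQ]
  | succ k ih =>
    refine abs_epochQ_le (η := fun _ => secondRate cN δ m (k + 1)) _ ?_
      (fun _ => Set.Ioc_subset_Icc_self (secondRate_mem_Ioc cN δ m (k + 1))) le_rfl ih _ s a
    change ((k + 1 : ℕ) : ℝ) / ((k + 1 : ℕ) + 1) ∈ Set.Icc (0 : ℝ) 1
    exact ⟨by positivity, div_le_one_of_le₀ (by linarith) (by positivity)⟩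

/-- The error of the second schedule, on the event that the noise is small in all epochs. -/
theorem BellmanPair.abs_finalQ_secondSchedule_sub_refQ_le [Nonempty S] [Finite A] [Nonempty A]
    (hM : M.BellmanPair J g H) (hH : 0 ≤ H) {cN δ : ℝ} {m : ℕ} (hc : 1000 ≤ cN) (hm : 2 ≤ m)
    (hδ0 : 0 < δ) (hδ1 : δ < 1) {x : ℕ → ℕ → S → A → S} {k : ℕ}
    (hz : ∀ j, 1 ≤ j → j ≤ k → ∀ s a,
      |M.noiseAvg g (fun _ => secondRate cN δ m j) (x j) (secondN cN δ m j) s a| ≤ H * (190 / j))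
    (s : S) (a : A) :
    |M.finalQ (secondSchedule cN δ m) x k s a - M.refQ J g (k / (k + 1)) s a| ≤
      (3 + 193 * H) * harmonic (k + 1) / (k + 1) := by
  have hJ := hM.gain_mem_Icc
  induction k generalizing s a with
  | zero =>
    -- The start Q = 0 is compared with `refQ` at γ = 0, as if an epoch 0 had ended there.
    have h1 := abs_le.1 (hM.abs_refQ_sub_le (γ := ((0 : ℕ) : ℝ) / ((0 : ℕ) + 1)) (by simp) s a)
    simp only [finalQ, harmonic_succ, harmonic_zero, zero_sub, abs_neg]
    simp only [Nat.cast_zero, sub_zero, one_mul, zero_add, div_one] at h1 ⊢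
    norm_num at h1 ⊢
    rw [abs_le]
    constructor <;> linarith [hJ.1, hJ.2]
  | succ k ih =>
    have ih' := ih fun j h1 h2 => hz j h1 (by omega)
    set κ : ℝ := (k : ℝ) + 1 with hκ
    have hk0 : (0 : ℝ) ≤ k := k.cast_nonneg
    have hκ1 : 1 ≤ κ := by linarith
    have hcast : ((k + 1 : ℕ) : ℝ) = κ := by push_cast; rfl
    rw [hcast]
    set γ : ℝ := κ / (κ + 1) with hγ
    have hγ1 : 1 - γ = 1 / (κ + 1) := by rw [hγ]; field_simp; ring
    have hγmem : γ ∈ Set.Icc (0 : ℝ) 1 :=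
      ⟨by positivity, div_le_one_of_le₀ (by linarith) (by positivity)⟩
    set d := (3 + 193 * H) * harmonic (k + 1) / κ with hd
    have he : ∀ s a, |M.finalQ (secondSchedule cN δ m) x k s a - M.refQ J g γ s a| ≤ 3 + H := by
      intro s a
      have h1 := abs_le.1 (M.abs_finalQ_secondSchedule_le cN δ m x k s a)
      have h2 := abs_le.1 (hM.abs_refQ_sub_le hγmem.2 s a)
      have h3 : (1 - γ) * (1 + H) ≤ 1 + H :=
        mul_le_of_le_one_left (by linarith) (by linarith [hγmem.1])
      rw [abs_le]
      constructor <;> linarith [hJ.1, hJ.2]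
    have hk1 : (k : ℝ) / κ ≤ 1 := div_le_one_of_le₀ (by linarith) (by linarith)
    have hW : ∀ s, |(⨆ a, M.finalQ (secondSchedule cN δ m) x k s a) - (J + (1 - γ) * g s)| ≤
        d + H / (κ * (κ + 1)) := by
      intro s
      have h1 : |(⨆ a, M.finalQ (secondSchedule cN δ m) x k s a) -
          (J + (1 - k / κ) * g s)| ≤ d := by
        rw [← hM.iSup_refQ hk1]
        exact abs_ciSup_sub_ciSup_le fun a => ih' s a
      have h2 : (1 - k / κ) - (1 - γ) = 1 / (κ * (κ + 1)) := by
        rw [hγ1, hκ]; field_simp; ring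
      have h3 : |(J + (1 - k / κ) * g s) - (J + (1 - γ) * g s)| ≤ H / (κ * (κ + 1)) := by
        rw [show (J + (1 - k / κ) * g s) - (J + (1 - γ) * g s) =
          ((1 - k / κ) - (1 - γ)) * g s by ring, h2, abs_mul, abs_of_nonneg (by positivity),
          abs_of_nonneg (hM.mem_Icc s).1, one_div_mul_eq_div]
        gcongr
        exact (hM.mem_Icc s).2
      exact (abs_sub_le _ _ _).trans (add_le_add h1 h3)
    have hd0 : 0 ≤ d := (abs_nonneg _).trans (ih' s a)
    have main := hM.abs_epochQ_epochStart_sub_le (γ := γ) (x := x (k + 1))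
      (η := fun _ => secondRate cN δ m (k + 1)) hγmem
      (fun _ => Set.Ioc_subset_Icc_self (secondRate_mem_Ioc cN δ m (k + 1))) he hW
      (by positivity) hH (secondN cN δ m (k + 1)) s a
    rw [Finset.prod_const, Finset.card_range] at main
    have hpow := one_sub_secondRate_pow_le hc hm hδ0 hδ1 (k := k + 1) (by omega)
    rw [hcast] at hpow
    have hnoise := hz (k + 1) (by omega) le_rfl s a
    rw [hcast] at hnoise
    have hn : |γ * (1 - γ) * M.noiseAvg g (fun _ => secondRate cN δ m (k + 1)) (x (k + 1))
        (secondN cN δ m (k + 1)) s a| ≤ γ * (1 - γ) * (H * (190 / κ)) := by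
      have hnn : 0 ≤ γ * (1 - γ) := mul_nonneg hγmem.1 (sub_nonneg.2 hγmem.2)
      rw [abs_mul, abs_of_nonneg hnn]
      exact mul_le_mul_of_nonneg_left hnoise hnn
    have hQ : M.finalQ (secondSchedule cN δ m) x (k + 1) s a =
        M.epochQ .epochStart γ (fun _ => secondRate cN δ m (k + 1)) (x (k + 1))
          (M.finalQ (secondSchedule cN δ m) x k) (secondN cN δ m (k + 1)) s a := by
      rw [finalQ, hγ, ← hcast]
      rfl
    rw [hQ]
    have hsplit := (abs_sub_le_iff.1 (abs_abs_sub_abs_le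
      (M.epochQ .epochStart γ (fun _ => secondRate cN δ m (k + 1)) (x (k + 1))
        (M.finalQ (secondSchedule cN δ m) x k) (secondN cN δ m (k + 1)) s a - M.refQ J g γ s a)
      (γ * (1 - γ) * M.noiseAvg g (fun _ => secondRate cN δ m (k + 1)) (x (k + 1))
        (secondN cN δ m (k + 1)) s a))).1
    have hp := mul_le_mul_of_nonneg_right hpow (show 0 ≤ 3 + H by linarith)
    -- An identity: γ d keeps the old harmonic number over κ+1, and the other terms add up to (3 +
    -- 193H)/(κ+1)², with 193 = 1 (start) + 1 (change of γ) + 1 (residual) + 190 (noise).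
    have hfin : 1 / (κ + 1) ^ 2 * (3 + H) + (γ * (d + H / (κ * (κ + 1))) + (1 - γ) ^ 2 * H) +
        γ * (1 - γ) * (H * (190 / κ)) ≤ (3 + 193 * H) * harmonic (k + 1 + 1) / (κ + 1) := by
      rw [harmonic_succ (k + 1)]
      push_cast
      rw [show (k : ℝ) + 1 + 1 = κ + 1 by rw [hκ], hγ1, hγ, hd]
      have e : (3 + 193 * H) * (harmonic (k + 1) + (κ + 1)⁻¹) / (κ + 1) -
          (1 / (κ + 1) ^ 2 * (3 + H) + (κ / (κ + 1) * ((3 + 193 * H) * harmonic (k + 1) / κ +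
            H / (κ * (κ + 1))) + (1 / (κ + 1)) ^ 2 * H) +
          κ / (κ + 1) * (1 / (κ + 1)) * (H * (190 / κ))) = 0 := by
        field_simp
        ring
      linarith
    linarith

theorem exists_secondSchedule_error_bound {c₀ : ℝ} (hc₀ : 0 < c₀) : ∃ C : ℝ, 0 < C ∧
      ∀ (S : Type u) (A : Type v) [Fintype S] [DecidableEq S] [Nonempty S]
        [MeasurableSpace S] [DiscreteMeasurableSpace S] [Fintype A] [Nonempty A]
        (M : FiniteMDP S A) (h : S → ℝ), M.IsOptimalBias h → c₀ ≤ spanNorm h →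
      ∀ (Ω : Type w) [MeasurableSpace Ω] (μ : Measure Ω) [IsProbabilityMeasure μ]
        (X : ℕ → ℕ → S → A → Ω → S), M.IsGenerativeModel μ X →
      ∀ δ : ℝ, 0 < δ → δ < 1 → ∀ cN : ℝ, 1000 ≤ cN → ∀ K : ℕ, 2 ≤ K →
        1 - δ ≤ μ.real {ω | M.finalError
            (secondSchedule cN δ (Fintype.card S * Fintype.card A)) X K ω ≤
          C * (spanNorm h * Real.log K / K)} := by
  refine ⟨4 * (4 / c₀ + 194), by positivity, ?_⟩
  intro S A _ _ _ _ _ _ _ M h hh hspan Ω _ μ _ X hX δ hδ0 hδ1 cN hcN K hK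
  have hM := hh.bellmanPair
  have hS := two_le_card_of_spanNorm_pos (hc₀.trans_le hspan)
  set H := spanNorm h
  have hH0 : 0 < H := hc₀.trans_le hspan
  have hm : 2 ≤ Fintype.card S * Fintype.card A :=
    hS.trans (Nat.le_mul_of_pos_right _ Fintype.card_pos)
  set m := Fintype.card S * Fintype.card A with hm_def
  have hm' : (2 : ℝ) ≤ m := by exact_mod_cast hm
  have hK' : (2 : ℝ) ≤ K := by exact_mod_cast hK
  have hlogK : 0.69 ≤ Real.log K := by
    linarith [Real.log_two_gt_d9, Real.log_le_log two_pos hK']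
  have hR : 0 ≤ 4 * (4 / c₀ + 194) * (H * Real.log K / K) := by positivity
  have hpos : ∀ k : ℕ, 1 ≤ k → 1 ≤ (2 * m * k * (k + 1) / δ : ℝ) := by
    intro k hk
    have hk' : (1 : ℝ) ≤ k := by exact_mod_cast hk
    rw [one_le_div hδ0]
    have h1 : (1 : ℝ) ≤ m * k := one_le_mul_of_one_le_of_one_le (by linarith) hk'
    nlinarith
  -- All epochs matter, but each only at its final time. Epoch k costs δ/(k(k+1)), which telescopes.
  refine hX.one_sub_le_of_noiseAvg_le (η := fun k _ => secondRate cN δ m k) hM.mem_Icc hH0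
    (fun k _ => secondRate_mem_Ioc cN δ m k) (fun k _ => ?_)
    (I := (Finset.Icc 1 K).map ⟨fun k => (k, secondN cN δ m k), fun _ _ h => (Prod.mk.inj h).1⟩)
    (L := fun i => Real.log (2 * m * i.1 * (i.1 + 1) / δ)) (fun i hi => ?_) ?_ fun ω hω => ?_
  · have := secondRate_mem_Ioc cN δ m k
    exact mul_le_of_le_one_left this.1.le (by linarith [this.1])
  · obtain ⟨k, hk, rfl⟩ := Finset.mem_map.1 hi
    exact Real.log_nonneg (hpos k (Finset.mem_Icc.1 hk).1)
  · rw [Finset.sum_map]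
    have e : ∀ k ∈ Finset.Icc 1 K, (Fintype.card S * Fintype.card A * (2 *
        Real.exp (-Real.log (2 * m * k * (k + 1) / δ))) : ℝ) =
        δ * (1 / (k : ℝ) - 1 / ((k + 1 : ℕ) : ℝ)) := by
      intro k hk
      have hk1 := (Finset.mem_Icc.1 hk).1
      have hk' : (1 : ℝ) ≤ k := by exact_mod_cast hk1
      rw [Real.exp_neg, Real.exp_log (by linarith [hpos k hk1]), ← Nat.cast_mul, ← hm_def]
      push_cast
      field_simp
      ring
    refine (Finset.sum_congr rfl e).trans_le ?_
    rw [← Finset.mul_sum]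
    refine mul_le_of_le_one_right hδ0.le ?_
    have tele : ∀ n : ℕ, ∑ k ∈ Finset.Icc 1 n, (1 / (k : ℝ) - 1 / ((k + 1 : ℕ) : ℝ)) =
        1 - 1 / ((n + 1 : ℕ) : ℝ) := by
      intro n
      induction n with
      | zero => simp
      | succ n ih => rw [Finset.sum_Icc_succ_top (by omega), ih]; ring
    rw [tele]
    have : 0 ≤ 1 / ((K + 1 : ℕ) : ℝ) := by positivity
    linarith
  · refine (finalError_le_iff hR).2 fun s a => ?_
    have h1 := hM.abs_finalQ_secondSchedule_sub_refQ_le hH0.le hcN hm hδ0 hδ1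
      (x := fun k t s a => X k t s a ω) (k := K) (fun j hj1 hjK s a =>
        (hω (j, secondN cN δ m j) (Finset.mem_map.2 ⟨j, Finset.mem_Icc.2 ⟨hj1, hjK⟩, rfl⟩) s
          a).trans (mul_le_mul_of_nonneg_left (secondRate_mul_log_le hcN hm hδ0 hδ1 hj1) hH0.le))
      s a
    have hγ : (K : ℝ) / (K + 1) ≤ 1 := div_le_one_of_le₀ (by linarith) (by linarith)
    have h2 := hM.abs_refQ_sub_le hγ s a
    have hγ1 : 1 - (K : ℝ) / (K + 1) = 1 / (K + 1) := by field_simp; ring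
    rw [hγ1] at h2
    refine (abs_sub_le _ _ _).trans ((add_le_add h1 h2).trans ?_)
    have hharm := harmonic_le_one_add_log (K + 1)
    push_cast at hharm
    have hlog : Real.log ((K : ℝ) + 1) ≤ 2 * Real.log K := by
      have e : 2 * Real.log K = Real.log ((K : ℝ) ^ 2) := by rw [Real.log_pow]; norm_num
      rw [e]
      exact Real.log_le_log (by linarith) (by nlinarith)
    have hharm4 : (harmonic (K + 1) : ℝ) ≤ 4 * Real.log K := by linarith
    have hHc : 1 ≤ H / c₀ := (one_le_div hc₀).2 hspan
    calc (3 + 193 * H) * (harmonic (K + 1) : ℝ) / (K + 1) + 1 / (K + 1) * (1 + H)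
        ≤ (3 + 193 * H) * (4 * Real.log K) / (K + 1) + 1 / (K + 1) * (1 + H) := by gcongr
      _ = ((3 + 193 * H) * (4 * Real.log K) + 1 * (1 + H)) / (K + 1) := by ring
      _ ≤ ((3 + 193 * H) * (4 * Real.log K) + (4 * Real.log K) * (1 + H)) / (K + 1) := by
          gcongr; linarith
      _ = (4 + 194 * H) * (4 * Real.log K) / (K + 1) := by ring
      _ ≤ (4 * (H / c₀) + 194 * H) * (4 * Real.log K) / K := by
          gcongr
          · linarith
          · linarith
      _ = _ := by ring

end FiniteMDP

/-! ### The main theorem. -/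

theorem mainTheorem1 :
    -- First schedule.
    (∀ c₀ c₁ c₂ : ℝ, 0 < c₀ → 0 < c₁ → 0 < c₂ → ∀ q : ℕ, ∃ C : ℝ, 0 < C ∧ ∃ p : ℕ,
      ∀ (S : Type u) (A : Type v) [Fintype S] [DecidableEq S] [Nonempty S]
        [MeasurableSpace S] [DiscreteMeasurableSpace S] [Fintype A] [Nonempty A]
        (M : FiniteMDP S A), M.IsWeaklyCommunicating →
      ∀ h : S → ℝ, M.IsOptimalBias h → c₀ ≤ FiniteMDP.spanNorm h →
      ∀ γ : ℕ → ℝ,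
        (∀ k : ℕ, 1 ≤ k →
          c₁ * Real.log (4 * FiniteMDP.firstN k) / (FiniteMDP.firstN k : ℝ) ^ (1 / 3 : ℝ)
              ≤ 1 - γ k ∧
            1 - γ k ≤ c₂ * Real.log (4 * FiniteMDP.firstN k) ^ q
              / (FiniteMDP.firstN k : ℝ) ^ (1 / 3 : ℝ)) →
      ∀ (Ω : Type w) [MeasurableSpace Ω] (μ : Measure Ω) [IsProbabilityMeasure μ]
        (X : ℕ → ℕ → S → A → Ω → S), M.IsGenerativeModel μ X →
      ∀ δ : ℝ, 0 < δ → δ < 1 →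
        (∀ K : ℕ, 1 ≤ K →
          1 - δ ≤ μ.real {ω | M.finalError (FiniteMDP.firstSchedule γ) X K ω ≤
            C * Real.log (Fintype.card S * Fintype.card A * FiniteMDP.firstN K / δ) ^ p *
              (FiniteMDP.spanNorm h / (FiniteMDP.firstN K : ℝ) ^ (1 / 3 : ℝ))}) ∧
        (∀ ε : ℝ, 0 < ε → ε ≤ 1 → ∃ K₀ : ℕ, 1 ≤ K₀ ∧
          (FiniteMDP.sampleCount (FiniteMDP.firstSchedule γ)
              (Fintype.card S * Fintype.card A) K₀ : ℝ) ≤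
            C * Real.log (2 + Fintype.card S * Fintype.card A * FiniteMDP.spanNorm h
                / (ε * δ)) ^ p *
              (Fintype.card S * Fintype.card A * (FiniteMDP.spanNorm h / ε) ^ 3) ∧
          ∀ K : ℕ, K₀ ≤ K →
            1 - δ ≤ μ.real {ω | M.finalError (FiniteMDP.firstSchedule γ) X K ω ≤ ε})) ∧
    -- Second schedule.
    (∃ cN₀ : ℝ, 0 < cN₀ ∧ ∀ c₀ : ℝ, 0 < c₀ → ∃ C : ℝ, 0 < C ∧
      ∀ (S : Type u) (A : Type v) [Fintype S] [DecidableEq S] [Nonempty S]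
        [MeasurableSpace S] [DiscreteMeasurableSpace S] [Fintype A] [Nonempty A]
        (M : FiniteMDP S A), M.IsWeaklyCommunicating →
      ∀ h : S → ℝ, M.IsOptimalBias h → c₀ ≤ FiniteMDP.spanNorm h →
      ∀ (Ω : Type w) [MeasurableSpace Ω] (μ : Measure Ω) [IsProbabilityMeasure μ]
        (X : ℕ → ℕ → S → A → Ω → S), M.IsGenerativeModel μ X →
      ∀ δ : ℝ, 0 < δ → δ < 1 → ∀ cN : ℝ, cN₀ ≤ cN → ∀ K : ℕ, 2 ≤ K →
        1 - δ ≤ μ.real {ω | M.finalError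
            (FiniteMDP.secondSchedule cN δ (Fintype.card S * Fintype.card A)) X K ω ≤
          C * (FiniteMDP.spanNorm h * Real.log K / K)}) := by
  refine ⟨fun c₀ c₁ c₂ hc₀ hc₁ hc₂ q => ?_, 1000, by norm_num, fun c₀ hc₀ => ?_⟩
  · obtain ⟨C, hC, p, hbound⟩ :=
      FiniteMDP.exists_firstSchedule_error_bound.{u, v, w} hc₀ hc₁ hc₂ q
    obtain ⟨C', hC', hsamples⟩ := FiniteMDP.exists_sampleCount_bound hc₀ hC p
    -- The sample count needs the cube of the error's logarithmic factor; the error bound tolerates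
    -- the larger exponent because its logarithm is at least 1.
    refine ⟨C + C', by positivity, 3 * p, ?_⟩
    intro S A _ _ _ _ _ _ _ M _ h hh hspan γ hγ Ω _ μ _ X hX δ hδ0 hδ1
    have key := hbound S A M h hh hspan γ hγ Ω μ X hX δ hδ0 hδ1
    have hH0 : 0 < FiniteMDP.spanNorm h := hc₀.trans_le hspan
    have hm : (1 : ℝ) ≤ Fintype.card S * Fintype.card A := by
      exact_mod_cast Nat.mul_pos Fintype.card_pos Fintype.card_pos
    refine ⟨fun K hK => (key K hK).trans (measureReal_mono fun ω hω => ?_),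
      fun ε hε0 hε1 => ?_⟩
    · simp only [Set.mem_ofPred_eq] at hω ⊢
      refine hω.trans ?_
      have hN : (1000 : ℝ) ≤ FiniteMDP.firstN K := by
        exact_mod_cast FiniteMDP.thousand_le_firstN K
      have hl : 1 ≤ Real.log (Fintype.card S * Fintype.card A * FiniteMDP.firstN K / δ) := by
        have : (1000 : ℝ) ≤ Fintype.card S * Fintype.card A * FiniteMDP.firstN K / δ := by
          rw [le_div_iff₀ hδ0]
          nlinarith
        rw [Real.le_log_iff_exp_le (by linarith)]
        linarith [Real.exp_one_lt_d9]
      have := pow_le_pow_right₀ hl (show p ≤ 3 * p by omega)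
      gcongr
      linarith
    · obtain ⟨K₀, hK₀, hcount, herr⟩ :=
        hsamples _ _ δ ε hm hspan hδ0 hδ1 hε0 hε1
      refine ⟨K₀, hK₀, ?_, fun K hK => (key K (hK₀.trans hK)).trans
        (measureReal_mono fun ω hω => ?_)⟩
      on_goal 2 =>
        simp only [Set.mem_ofPred_eq] at hω ⊢
        exact hω.trans (herr K hK)
      have hl : 0 ≤ Real.log (2 + Fintype.card S * Fintype.card A * FiniteMDP.spanNorm h
          / (ε * δ)) := by
        have : 0 ≤ Fintype.card S * Fintype.card A * FiniteMDP.spanNorm h / (ε * δ) := by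
          positivity
        exact Real.log_nonneg (by linarith)
      simp only [FiniteMDP.sampleCount, FiniteMDP.firstSchedule]
      push_cast
      refine hcount.trans ?_
      gcongr
      linarith
  · obtain ⟨C, hC, hbound⟩ := FiniteMDP.exists_secondSchedule_error_bound.{u, v, w} hc₀
    exact ⟨C, hC, fun S A _ _ _ _ _ _ _ M _ h hh hspan => hbound S A M h hh hspan⟩
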